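/- \textbf{Setting.} Let $M^\star\in\mathbb{R}^{n\times n}$ be positive semidefinite and nonzero, $r^\star=\mathrm{rank}(M^\star)$, $r\ge r^\star$, and let $\lambda_{r^\star}(M^\star)$ be its $r^\star$-th largest (that is, smallest nonzero) eigenvalue. Let $A_1,\dots,A_m\in\mathbb{R}^{n\times n}$ be fixed and $\mathcal{A}(M)=(\langle A_1,M\rangle,\dots,\langle A_m,M\rangle)\in\mathbb{R}^m$. Suppose that $\mathcal{A}$ satisfies RIP with parameters $(2r,\delta)$, $0\le\delta<1$: for every symmetric $M$ with $\mathrm{rank}(M)\le 2r$, $$(1-\delta)\|M\|_F^2\le \tfrac1m\|\mathcal{A}(M)\|^2\le(1+\delta)\|M\|_F^2 .$$ We observe $y=\mathcal{A}(M^\star)+\epsilon$, where $\epsilon_1,\dots,\epsilon_m$ are independent with zero mean, $\sigma\ge0$, $\sigma^2=\frac1m\sum_{i=1}^m\mathbb{E}[\epsilon_i^2]$, and each $\epsilon_i$ is sub-Gaussian with variance proxy $\kappa\sigma^2$, i.e. $\mathbb{E}[e^{t\epsilon_i}]\le e^{\kappa\sigma^2t^2/2}$ for all $t\in\mathbb{R}$,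 for some $\kappa>0$. Put $f(X)=\frac1m\|y-\mathcal{A}(XX^T)\|^2$ for $X\in\mathbb{R}^{n\times r}$. For $\hat\sigma^2\ge0$ (an approximation of $\sigma^2$), a step-size $\alpha$ and an initial point $X_0$, let $$X_{k+1}=X_k-\alpha\nabla f(X_k)(X_k^TX_k+\eta_kI_r)^{-1},\qquad \eta_k=\sqrt{|f(X_k)-\hat\sigma^2|}.$$ Let $0<\rho<1$ satisfy $\rho^2/(1-\rho^2)\le(1-\delta^2)/2$, and let $$\mu_P=\left(\sqrt{\tfrac{1+\delta^2}{2}}-\delta\right)^2\min\left\{\left(1+\tfrac{C_{ub}}{\sqrt2-1}\right)^{-1},\left(1+3C_{ub}\sqrt{\tfrac{r-r^\star}{1-\delta^2}}\right)^{-1}\right\},\qquad C_{ub}=\sqrt{1+\delta}.$$ \textbf{Theorem 8 (noisy measurements with variance proxy).} For every $\delta_0<1$ there is a constant $L>0$ that depends only on $\delta_0$, and for every $\kappa>0$ there are constants $C,c,c'>0$ that depend only on $\delta_0$ and $\kappa$, such that the following holds in the above setting whenever $\delta\le\delta_0$. With probability at least $1-c\,n^{-c'}$, simultaneously for all $X_0$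 with $\frac1m\|\mathcal{A}(X_0X_0^T-M^\star)\|^2<\rho^2(1-\delta)\lambda_{r^\star}(M^\star)^2$, all $0<\alpha\le1/L$, all $\hat\sigma^2\ge0$, all $K\ge0$ and every $k^*\in\arg\min_{0\le k\le K}\eta_k$, $$\|X_{k^*}X_{k^*}^T-M^\star\|_F^2\le C\max\left\{\frac{1+\delta}{1-\delta}\left(1-\alpha\frac{\mu_P}{2}\right)^K\|X_0X_0^T-M^\star\|_F^2,\ \mathcal{E}_{stat},\ \mathcal{E}_{dev},\ \mathcal{E}_{var}\right\},$$ where $$\mathcal{E}_{stat}=\frac{\sigma^2nr\log n}{\mu_P(1-\delta)m},\qquad \mathcal{E}_{dev}=\frac{\sigma^2}{1-\delta}\sqrt{\frac{\log n}{m}},\qquad \mathcal{E}_{var}=|\sigma^2-\hat\sigma^2| .$$ -/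

import Mathlib

open MeasureTheory ProbabilityTheory Matrix
open scoped NNReal Matrix.Norms.Frobenius

-- From here on, the norm of a matrix is the Frobenius norm.

noncomputable section

namespace PrecGD

/-- The linear measurement operator `𝒜(M) = (⟨A₁, M⟩, …, ⟨Aₘ, M⟩) ∈ ℝᵐ`, where
`⟨A, M⟩ = tr(Aᵀ M)` and `ℝᵐ` carries the Euclidean norm. -/
def sense {n m : ℕ} (A : Fin m → Matrix (Fin n) (Fin n) ℝ) (M : Matrix (Fin n) (Fin n) ℝ) :
    EuclideanSpace ℝ (Fin m) :=
  WithLp.toLp 2 fun i => ((A i)ᵀ * M).trace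

/-- The restricted isometry property with parameters `(k, δ)`. It is required of symmetric matrices
only: this is weaker than requiring it of all matrices of rank at most `k`, and it does not exclude
symmetric measurement matrices (which annihilate every skew-symmetric matrix). -/
def RIP {n m : ℕ} (A : Fin m → Matrix (Fin n) (Fin n) ℝ) (k : ℕ) (δ : ℝ) : Prop :=
  ∀ M : Matrix (Fin n) (Fin n) ℝ, M.IsSymm → M.rank ≤ k →
    (1 - δ) * ‖M‖ ^ 2 ≤ 1 / (m : ℝ) * ‖sense A M‖ ^ 2 ∧
      1 / (m : ℝ) * ‖sense A M‖ ^ 2 ≤ (1 + δ) * ‖M‖ ^ 2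

/-- The `k`-th largest eigenvalue (`k = 1, …, n`, with multiplicity) of a real symmetric matrix. -/
def lam {n : ℕ} {M : Matrix (Fin n) (Fin n) ℝ} (hM : M.IsHermitian) (k : ℕ) : ℝ :=
  if h : k - 1 < Fintype.card (Fin n) then hM.eigenvalues₀ ⟨k - 1, h⟩ else 0

/-- The vector of noisy measurements `y = 𝒜(M⋆) + ε`. -/
def noisyData {n m : ℕ} (A : Fin m → Matrix (Fin n) (Fin n) ℝ) (Mstar : Matrix (Fin n) (Fin n) ℝ)
    (e : Fin m → ℝ) : EuclideanSpace ℝ (Fin m) :=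
  sense A Mstar + WithLp.toLp 2 e

/-- The empirical loss `f(X) = (1/m) ‖y - 𝒜(X Xᵀ)‖²`. -/
def loss {n m r : ℕ} (A : Fin m → Matrix (Fin n) (Fin n) ℝ) (y : EuclideanSpace ℝ (Fin m))
    (X : Matrix (Fin n) (Fin r) ℝ) : ℝ :=
  1 / (m : ℝ) * ‖y - sense A (X * Xᵀ)‖ ^ 2

/-- The gradient of a function of a matrix: the matrix of its partial derivatives. -/
def matGrad {n r : ℕ} (f : Matrix (Fin n) (Fin r) ℝ → ℝ) (X : Matrix (Fin n) (Fin r) ℝ) :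
    Matrix (Fin n) (Fin r) ℝ :=
  Matrix.of fun i j => lineDeriv ℝ f X (Matrix.single i j 1)

/-- The damping parameter `η = √|f(X) - σ̂²|`. -/
def damping {n m r : ℕ} (A : Fin m → Matrix (Fin n) (Fin n) ℝ) (y : EuclideanSpace ℝ (Fin m))
    (σhat : ℝ) (X : Matrix (Fin n) (Fin r) ℝ) : ℝ :=
  √|loss A y X - σhat ^ 2|

/-- The iterates of preconditioned gradient descent,
`X_{k+1} = X_k - α ∇f(X_k) (X_kᵀ X_k + η_k I)⁻¹` with `η_k = √|f(X_k) - σ̂²|`. -/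
def iter {n m r : ℕ} (A : Fin m → Matrix (Fin n) (Fin n) ℝ) (y : EuclideanSpace ℝ (Fin m))
    (σhat α : ℝ) (X₀ : Matrix (Fin n) (Fin r) ℝ) : ℕ → Matrix (Fin n) (Fin r) ℝ
  | 0 => X₀
  | k + 1 =>
      iter A y σhat α X₀ k -
        α • (matGrad (loss A y) (iter A y σhat α X₀ k) *
          ((iter A y σhat α X₀ k)ᵀ * iter A y σhat α X₀ k +
            damping A y σhat (iter A y σhat α X₀ k) • (1 : Matrix (Fin r) (Fin r) ℝ))⁻¹)

/-- The gradient dominance constant `μ_P` for RIP constant `δ`, search rank `r`, true rank `rs`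
and the upper bound `Cub` on the ratio of the damping parameter to the error. -/
def muP (δ Cub : ℝ) (r rs : ℕ) : ℝ :=
  (√((1 + δ ^ 2) / 2) - δ) ^ 2 *
    min (1 + Cub / (√2 - 1))⁻¹ (1 + 3 * Cub * √(((r : ℝ) - rs) / (1 - δ ^ 2)))⁻¹

/-- The statistical error `σ² n r log n / (μ_P (1 - δ) m)`. -/
def errStat (n m r : ℕ) (σ δ μP : ℝ) : ℝ :=
  σ ^ 2 * n * r * Real.log n / (μP * (1 - δ) * m)

/-- The error due to the deviation of the empirical noise variance from its mean. -/
def errDev (n m : ℕ) (σ δ : ℝ) : ℝ :=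
  σ ^ 2 / (1 - δ) * √(Real.log n / m)

/-- The error of the approximation of the noise variance. -/
def errVar (σ σhat : ℝ) : ℝ :=
  |σ ^ 2 - σhat ^ 2|

end PrecGD

end

/-!
Write `E = X Xᵀ - M⋆` for the error of an iterate and `g(X) = (1/m) ‖𝒜(E)‖²` for the noiseless loss,
which by restricted isometry is comparable with `‖E‖²`. The squared damping parameter `η²` agrees
with `g(X)` up to the noise (`abs_damping_sq_sub_le`), so that as long as the error dominates the
noise, `η` is comparable with `‖E‖`. The descent is measured in the norm
`‖V‖²_P = ‖V Xᵀ‖² + η ‖V‖²` that the preconditioner induces on directions `V` (`precSq`).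

*Gradient dominance* (`exists_ascent_direction`). The initial condition keeps `‖E‖` below
`ρ λ_{r⋆}`. Let `P` be the spectral projection of `X Xᵀ` onto its eigenvalues above `t₀ ‖E‖`, with a
small `t₀`. At most `r - r⋆` of the `r` eigenvalues of `Xᵀ X` lie below this threshold, so their
contribution to `E` is small, and the eigenvalue gap of `M⋆` shows that
`(1 - P) M⋆ (1 - P)` is small as well. Therefore the corner `(1 - P) E (1 - P)` carries at most the
fraction `(1 - δ²) / 2` of `‖E‖²`, and the remainder of `E` is `V Xᵀ + X Vᵀ` for a `V` supported on
the eigenspaces above the threshold, which makes `η ‖V‖²` at most a multiple of `‖V Xᵀ‖²`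
(`exists_truncation`). Polarizing the restricted isometry property turns the resulting cosine into
the bound `√(2 μ_P) ‖E‖ ‖V‖_P` for the derivative of `g` along `V`. So the gradient has dual norm at
least `√(2 μ_P) ‖E‖`, up to the noise.

*Smoothness* (`one_step`). Along the preconditioned step the loss is a quartic polynomial in `α`,
and `η ≥ h ‖E‖` bounds its coefficients by multiples of the squared dual norm of the gradient. Hence
a step with small `α` multiplies `g` by at most `1 - α μ_P / 2`, unless the error is already at the
noise level. So one of the first `K` iterates is as accurate as claimed, and since `η²` is `g` up to
the noise, the iterate of smallest `η` is so too (`convergence_of_noise_le`).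

*Noise* (`exists_noise_event`). The noise enters through `(1/m) ⟨ε, 𝒜(Y)⟩ = ⟨S, Y⟩` for symmetric
`Y` of rank at most `2 r` and through `(1/m) ‖ε‖² - σ²`. The former is at most `√(2 r) ‖Y‖` times
the maximum of `|uᵀ S u|` on the unit ball, which rounding to a grid reduces to a union bound over
Hoeffding's inequality. The latter is Bernstein's inequality for the squares of sub-Gaussian
variables. It needs `log n ≤ m`, which restricted isometry provides (`RIP.dim_le`).
-/

noncomputable section

namespace PrecGD

/-! ### The trace inner product -/

section frobenius

variable {ι κ τ : Type*} [Fintype ι] [Fintype κ] [Fintype τ]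

/-- The trace inner product `⟨A, B⟩ = tr(Aᵀ B)`, which induces the Frobenius norm. -/
def ip (A B : Matrix ι κ ℝ) : ℝ := (Aᵀ * B).trace

lemma ip_eq_sum (A B : Matrix ι κ ℝ) : ip A B = ∑ i, ∑ j, A i j * B i j := by
  simp only [ip, Matrix.trace, Matrix.diag, Matrix.mul_apply, Matrix.transpose_apply]
  exact Finset.sum_comm

lemma ip_comm (A B : Matrix ι κ ℝ) : ip A B = ip B A := by
  simp only [ip_eq_sum, mul_comm]

lemma ip_add_left (A B C : Matrix ι κ ℝ) : ip (A + B) C = ip A C + ip B C := by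
  simp [ip, Matrix.add_mul]

lemma ip_add_right (A B C : Matrix ι κ ℝ) : ip A (B + C) = ip A B + ip A C := by
  simp [ip, Matrix.mul_add]

lemma ip_sub_left (A B C : Matrix ι κ ℝ) : ip (A - B) C = ip A C - ip B C := by
  simp [ip, Matrix.sub_mul]

lemma ip_sub_right (A B C : Matrix ι κ ℝ) : ip A (B - C) = ip A B - ip A C := by
  simp [ip, Matrix.mul_sub]

lemma ip_smul_left (a : ℝ) (A B : Matrix ι κ ℝ) : ip (a • A) B = a * ip A B := by
  simp [ip]

lemma ip_smul_right (a : ℝ) (A B : Matrix ι κ ℝ) : ip A (a • B) = a * ip A B := by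
  simp [ip]

lemma ip_transpose (A B : Matrix ι κ ℝ) : ip Aᵀ Bᵀ = ip A B := by
  simp only [ip_eq_sum, Matrix.transpose_apply]
  exact Finset.sum_comm

lemma ip_mul_left (A : Matrix ι τ ℝ) (B : Matrix τ κ ℝ) (C : Matrix ι κ ℝ) :
    ip (A * B) C = ip B (Aᵀ * C) := by
  simp [ip, Matrix.transpose_mul, Matrix.mul_assoc]

lemma ip_mul_right (A : Matrix ι τ ℝ) (B : Matrix τ κ ℝ) (C : Matrix ι κ ℝ) :
    ip (A * B) C = ip A (C * Bᵀ) := by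
  rw [← ip_transpose, Matrix.transpose_mul, ip_mul_left, ← ip_transpose]
  simp [Matrix.transpose_mul]

lemma ip_self (A : Matrix ι κ ℝ) : ip A A = ‖A‖ ^ 2 := by
  rw [ip_eq_sum, Matrix.frobenius_norm_def, ← Real.sqrt_eq_rpow, Real.sq_sqrt]
  · simp [sq]
  · positivity

lemma norm_sq_add (A B : Matrix ι κ ℝ) : ‖A + B‖ ^ 2 = ‖A‖ ^ 2 + 2 * ip A B + ‖B‖ ^ 2 := by
  rw [← ip_self, ← ip_self, ← ip_self, ip_add_left, ip_add_right, ip_add_right, ip_comm B A]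
  ring

lemma norm_sq_sub (A B : Matrix ι κ ℝ) : ‖A - B‖ ^ 2 = ‖A‖ ^ 2 - 2 * ip A B + ‖B‖ ^ 2 := by
  rw [← ip_self, ← ip_self, ← ip_self, ip_sub_left, ip_sub_right, ip_sub_right, ip_comm B A]
  ring

lemma ip_le (A B : Matrix ι κ ℝ) : ip A B ≤ ‖A‖ * ‖B‖ := by
  rcases eq_or_ne A 0 with rfl | hA
  · simp [ip]
  rcases eq_or_ne B 0 with rfl | hB
  · simp [ip]
  have hA' : 0 < ‖A‖ := norm_pos_iff.2 hA
  have hB' : 0 < ‖B‖ := norm_pos_iff.2 hB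
  have h := norm_sq_sub (‖B‖ • A) (‖A‖ • B)
  rw [norm_smul, norm_smul, ip_smul_left, ip_smul_right, norm_norm, norm_norm] at h
  have h0 := sq_nonneg ‖‖B‖ • A - ‖A‖ • B‖
  have : 0 ≤ (‖A‖ * ‖B‖) * (‖A‖ * ‖B‖ - ip A B) := by nlinarith
  have := nonneg_of_mul_nonneg_right this (by positivity)
  linarith

lemma abs_ip_le (A B : Matrix ι κ ℝ) : |ip A B| ≤ ‖A‖ * ‖B‖ := by
  refine abs_le.2 ⟨?_, ip_le A B⟩
  have := ip_le (-1 • A : Matrix ι κ ℝ) B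
  rw [show ((-1 : ℤ) • A : Matrix ι κ ℝ) = (-1 : ℝ) • A by simp, ip_smul_left, norm_smul] at this
  simp at this
  linarith

lemma norm_mul_le_frob (A : Matrix ι τ ℝ) (B : Matrix τ κ ℝ) : ‖A * B‖ ≤ ‖A‖ * ‖B‖ :=
  Matrix.frobenius_norm_mul A B

lemma norm_transpose_frob (A : Matrix ι κ ℝ) : ‖Aᵀ‖ = ‖A‖ := Matrix.frobenius_norm_transpose A

lemma trace_sq_of_symm {A : Matrix ι ι ℝ} (hA : Aᵀ = A) : (A * A).trace = ‖A‖ ^ 2 := by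
  rw [← ip_self, ip, hA]

/-! ### Positive semidefinite matrices -/

omit [Fintype ι] in
lemma posSemidef_transpose_eq {A : Matrix ι ι ℝ} (hA : A.PosSemidef) : Aᵀ = A := by
  have := hA.isHermitian.eq
  rwa [Matrix.conjTranspose_eq_transpose_of_trivial] at this

lemma ip_conj_nonneg {A : Matrix ι ι ℝ} (hA : A.PosSemidef) (B : Matrix ι κ ℝ) :
    0 ≤ ip B (A * B) := by
  have := (hA.conjTranspose_mul_mul_same B).trace_nonneg
  rw [Matrix.conjTranspose_eq_transpose_of_trivial, Matrix.mul_assoc] at this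
  exact this

/-! ### Functional calculus of a symmetric matrix -/

section calculus

variable [DecidableEq ι] {W : Matrix ι ι ℝ} (hW : W.IsHermitian)

/-- The matrix `f(W)`, where the function `f` is given by its values at the (indexed) eigenvalues
of the symmetric matrix `W`. -/
def fcalc (f : ι → ℝ) : Matrix ι ι ℝ :=
  (hW.eigenvectorUnitary : Matrix ι ι ℝ) * Matrix.diagonal f *
    (hW.eigenvectorUnitary : Matrix ι ι ℝ)ᵀ

lemma eigU_transpose_mul :
    (hW.eigenvectorUnitary : Matrix ι ι ℝ)ᵀ * (hW.eigenvectorUnitary : Matrix ι ι ℝ) = 1 := by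
  have := Unitary.coe_star_mul_self hW.eigenvectorUnitary
  rwa [Matrix.star_eq_conjTranspose, Matrix.conjTranspose_eq_transpose_of_trivial] at this

lemma eigU_mul_transpose :
    (hW.eigenvectorUnitary : Matrix ι ι ℝ) * (hW.eigenvectorUnitary : Matrix ι ι ℝ)ᵀ = 1 :=
  mul_eq_one_comm.1 (eigU_transpose_mul hW)

lemma fcalc_eigenvalues : fcalc hW hW.eigenvalues = W := by
  conv_rhs => rw [hW.spectral_theorem]
  simp [fcalc, Unitary.conjStarAlgAut_apply, Matrix.star_eq_conjTranspose,
    Matrix.conjTranspose_eq_transpose_of_trivial]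

lemma fcalc_one : fcalc hW (fun _ => 1) = 1 := by
  simp [fcalc, eigU_mul_transpose]

lemma fcalc_mul (f g : ι → ℝ) : fcalc hW f * fcalc hW g = fcalc hW (fun i => f i * g i) := by
  simp only [fcalc, Matrix.mul_assoc]
  rw [← Matrix.mul_assoc (hW.eigenvectorUnitary : Matrix ι ι ℝ)ᵀ, eigU_transpose_mul,
    Matrix.one_mul, ← Matrix.mul_assoc (diagonal f), Matrix.diagonal_mul_diagonal]

lemma fcalc_mul_self (f : ι → ℝ) :
    fcalc hW f * W = fcalc hW (fun i => f i * hW.eigenvalues i) := by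
  rw [← fcalc_mul, fcalc_eigenvalues]

lemma self_mul_fcalc (f : ι → ℝ) :
    W * fcalc hW f = fcalc hW (fun i => hW.eigenvalues i * f i) := by
  rw [← fcalc_mul, fcalc_eigenvalues]

lemma fcalc_sub (f g : ι → ℝ) : fcalc hW f - fcalc hW g = fcalc hW (fun i => f i - g i) := by
  simp only [fcalc, ← Matrix.sub_mul, ← Matrix.mul_sub, Matrix.diagonal_sub]

lemma fcalc_smul (a : ℝ) (f : ι → ℝ) : a • fcalc hW f = fcalc hW (fun i => a * f i) := by
  rw [fcalc, fcalc, ← Matrix.smul_mul, ← Matrix.mul_smul, ← Matrix.diagonal_smul]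
  rfl

lemma fcalc_transpose (f : ι → ℝ) : (fcalc hW f)ᵀ = fcalc hW f := by
  simp [fcalc, Matrix.transpose_mul, Matrix.mul_assoc]

lemma fcalc_trace (f : ι → ℝ) : (fcalc hW f).trace = ∑ i, f i := by
  rw [fcalc, Matrix.trace_mul_comm, ← Matrix.mul_assoc, eigU_transpose_mul, Matrix.one_mul,
    Matrix.trace_diagonal]

lemma fcalc_posSemidef {f : ι → ℝ} (hf : ∀ i, 0 ≤ f i) : (fcalc hW f).PosSemidef := by
  have := (Matrix.PosSemidef.diagonal (d := f) hf).mul_mul_conjTranspose_same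
    (hW.eigenvectorUnitary : Matrix ι ι ℝ)
  rwa [Matrix.conjTranspose_eq_transpose_of_trivial] at this

lemma fcalc_rank_le (f : ι → ℝ) :
    (fcalc hW f).rank ≤ (Finset.univ.filter fun i => f i ≠ 0).card := by
  refine (Matrix.rank_mul_le_left _ _).trans ((Matrix.rank_mul_le_right _ _).trans ?_)
  rw [Matrix.rank_diagonal, Fintype.card_subtype]

lemma exists_factor {A : Matrix ι ι ℝ} (hA : A.PosSemidef) :
    ∃ B : Matrix ι ι ℝ, A = Bᵀ * B := by
  refine ⟨fcalc hA.isHermitian fun i => √(hA.isHermitian.eigenvalues i), ?_⟩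
  rw [fcalc_transpose, fcalc_mul]
  simp only [Real.mul_self_sqrt (hA.eigenvalues_nonneg _)]
  exact (fcalc_eigenvalues _).symm

lemma norm_le_trace {A : Matrix ι ι ℝ} (hA : A.PosSemidef) : ‖A‖ ≤ A.trace := by
  obtain ⟨B, rfl⟩ := exists_factor hA
  calc ‖Bᵀ * B‖ ≤ ‖Bᵀ‖ * ‖B‖ := norm_mul_le_frob _ _
    _ = (Bᵀ * B).trace := by
      rw [norm_transpose_frob, ← sq, ← ip_self, ip]

lemma ip_nonneg_of_posSemidef {A B : Matrix ι ι ℝ} (hA : A.PosSemidef)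
    (hB : B.PosSemidef) : 0 ≤ ip A B := by
  obtain ⟨C, rfl⟩ := exists_factor hB
  have h := ip_conj_nonneg hA Cᵀ
  rwa [ip_comm, ip_mul_left, Matrix.transpose_transpose, ← ip_transpose, Matrix.transpose_mul,
    posSemidef_transpose_eq hA]

end calculus

end frobenius

/-! ### Eigenvalues of the target matrix -/

lemma eigenvalues_eq_zero_or_lam_le {n rs : ℕ} {M : Matrix (Fin n) (Fin n) ℝ} (hM : M.PosSemidef)
    (hrank : M.rank = rs) (i : Fin n) :
    hM.isHermitian.eigenvalues i = 0 ∨ lam hM.isHermitian rs ≤ hM.isHermitian.eigenvalues i := by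
  have hH := hM.isHermitian
  let e : Fin (Fintype.card (Fin n)) ≃ Fin n := Fintype.equivOfCardEq (Fintype.card_fin _)
  have he : ∀ i, hH.eigenvalues i = hH.eigenvalues₀ (e.symm i) := fun i => rfl
  by_cases h0 : hM.isHermitian.eigenvalues i = 0
  · exact Or.inl h0
  right
  have hpos : 0 < hH.eigenvalues i := lt_of_le_of_ne (hM.eigenvalues_nonneg i) (Ne.symm h0)
  set j := e.symm i with hj
  have hcard : (j : ℕ) + 1 ≤ rs := by
    rw [← hrank, hH.rank_eq_card_non_zero_eigs, Fintype.card_subtype]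
    have hsub : (Finset.Iic j).map e.toEmbedding ⊆
        Finset.univ.filter fun i => hH.eigenvalues i ≠ 0 := by
      intro x hx
      obtain ⟨y, hy, rfl⟩ := Finset.mem_map.1 hx
      have hy' : y ≤ j := Finset.mem_Iic.1 hy
      simp only [Finset.mem_filter, Finset.mem_univ, true_and, he]
      have := hH.eigenvalues₀_antitone hy'
      rw [he] at hpos
      simp only [Equiv.coe_toEmbedding, Equiv.symm_apply_apply]
      exact (hpos.trans_le this).ne'
    have := Finset.card_le_card hsub
    simpa using this
  unfold lam
  split_ifs with h
  · rw [he]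
    apply hH.eigenvalues₀_antitone
    rw [Fin.le_def]
    simp only
    omega
  · exact hM.eigenvalues_nonneg i

lemma lam_nonneg {n rs : ℕ} {M : Matrix (Fin n) (Fin n) ℝ} (hM : M.PosSemidef) :
    0 ≤ lam hM.isHermitian rs := by
  unfold lam
  split_ifs with h
  · let e : Fin (Fintype.card (Fin n)) ≃ Fin n := Fintype.equivOfCardEq (Fintype.card_fin _)
    have := hM.eigenvalues_nonneg (e ⟨rs - 1, h⟩)
    have he : hM.isHermitian.eigenvalues (e ⟨rs - 1, h⟩) =
      hM.isHermitian.eigenvalues₀ (e.symm (e ⟨rs - 1, h⟩)) := rfl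
    rwa [he, Equiv.symm_apply_apply] at this
  · exact le_rfl

section gap

variable {n : ℕ} {M : Matrix (Fin n) (Fin n) ℝ} (hM : M.PosSemidef) {l : ℝ}
  (hl : ∀ i, hM.isHermitian.eigenvalues i = 0 ∨ l ≤ hM.isHermitian.eigenvalues i)

include hl

/-- `l M ≤ M²` when the nonzero eigenvalues of `M` are at least `l`. -/
lemma mul_ip_le_norm_sq {κ : Type*} [Fintype κ] (B : Matrix (Fin n) κ ℝ) :
    l * ip B (M * B) ≤ ‖M * B‖ ^ 2 := by
  have h := hM.isHermitian
  have hpsd : (M * M - l • M).PosSemidef := by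
    rw [← fcalc_eigenvalues h, fcalc_mul, fcalc_smul, fcalc_sub]
    apply fcalc_posSemidef
    intro i
    rcases hl i with h0 | h0
    · simp [h0]
    · have := hM.eigenvalues_nonneg i
      nlinarith
  have h1 := ip_conj_nonneg hpsd B
  rw [Matrix.sub_mul, ip_sub_right, Matrix.smul_mul, ip_smul_right, Matrix.mul_assoc] at h1
  rw [← ip_self, ip_mul_left, posSemidef_transpose_eq hM]
  linarith

/-- `M ≥ l` on the range of `M` when the nonzero eigenvalues of `M` are at least `l`. -/
lemma mul_norm_sq_le_ip_range {κ : Type*} [Fintype κ] (B : Matrix (Fin n) κ ℝ) :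
    l * ‖M * B‖ ^ 2 ≤ ip (M * B) (M * (M * B)) := by
  have h := hM.isHermitian
  have hpsd : (M * (M * M) - l • (M * M)).PosSemidef := by
    rw [← fcalc_eigenvalues h, fcalc_mul, fcalc_mul, fcalc_smul, fcalc_sub]
    apply fcalc_posSemidef
    intro i
    rcases hl i with h0 | h0
    · simp [h0]
    · nlinarith [mul_self_nonneg (h.eigenvalues i)]
  have h1 := ip_conj_nonneg hpsd B
  rw [Matrix.sub_mul, ip_sub_right, Matrix.smul_mul, ip_smul_right] at h1
  rw [← ip_self, ip_mul_left, ip_mul_left, posSemidef_transpose_eq hM]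
  simp only [Matrix.mul_assoc] at h1 ⊢
  linarith

end gap

lemma rank_le_rank_of_mul_eq_zero {n : ℕ} {M P : Matrix (Fin n) (Fin n) ℝ}
    (h : ∀ z : Matrix (Fin n) (Fin 1) ℝ, P * (M * z) = 0 → M * z = 0) : M.rank ≤ P.rank := by
  have hker : LinearMap.ker (P * M).mulVecLin = LinearMap.ker M.mulVecLin := by
    ext z
    simp only [LinearMap.mem_ker, Matrix.mulVecLin_apply]
    constructor
    · intro hz
      have h1 := h (Matrix.replicateCol (Fin 1) z)
      rw [← Matrix.mul_assoc, ← Matrix.replicateCol_mulVec, ← Matrix.replicateCol_mulVec, hz] at h1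
      have h2 := h1 (by ext; simp)
      ext i
      simpa using congrFun (congrFun h2 i) 0
    · intro hz
      rw [← Matrix.mulVec_mulVec, hz, Matrix.mulVec_zero]
  have h1 := LinearMap.finrank_range_add_finrank_ker (P * M).mulVecLin
  have h2 := LinearMap.finrank_range_add_finrank_ker M.mulVecLin
  rw [hker] at h1
  have : M.rank = (P * M).rank := by
    unfold Matrix.rank
    omega
  rw [this]
  exact Matrix.rank_mul_le_left _ _

/-! ### The leading part of the iterate -/

/-- A truncated inverse `Φ` of the Gram matrix `W = Xᵀ X`: on the eigenvectors whose eigenvalue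
exceeds the threshold `t` it inverts `W`, and the others it kills. `Ψ = 1 - Φ W` is the projection
onto the latter, and `k` is the number of the former. -/
lemma exists_truncated_inverse {r : ℕ} {W : Matrix (Fin r) (Fin r) ℝ} (hW : W.PosSemidef) {t : ℝ}
    (ht : 0 < t) :
    ∃ (Φ Ψ : Matrix (Fin r) (Fin r) ℝ) (k : ℕ), Φᵀ = Φ ∧ Ψ = 1 - Φ * W ∧ Ψ = 1 - W * Φ ∧
      Φ * W * Φ = Φ ∧ Ψ.PosSemidef ∧ (Φ - t • (Φ * Φ)).PosSemidef ∧
      (t • Ψ - Ψ * W * Ψ).PosSemidef ∧ Φ.rank ≤ k ∧ k ≤ r ∧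
      (Ψ * W * (Ψ * W)).trace ≤ ((r : ℝ) - k) * t ^ 2 := by
  have hH := hW.isHermitian
  set e := hH.eigenvalues with he
  set φ : Fin r → ℝ := fun i => if t < e i then (e i)⁻¹ else 0 with hφ
  set ψ : Fin r → ℝ := fun i => if t < e i then 0 else 1 with hψ
  have h1 : fcalc hH ψ = 1 - fcalc hH φ * W := by
    rw [← fcalc_one hH, fcalc_mul_self, fcalc_sub]
    congr 1
    ext i
    rw [← he]
    by_cases h : t < e i
    · simp [hφ, hψ, h, inv_mul_cancel₀ (ht.trans h).ne']
    · simp [hφ, hψ, h]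
  have h2 : fcalc hH ψ = 1 - W * fcalc hH φ := by
    rw [h1, fcalc_mul_self, self_mul_fcalc]
    simp only [mul_comm]
  refine ⟨fcalc hH φ, fcalc hH ψ, (Finset.univ.filter fun i => φ i ≠ 0).card, fcalc_transpose _ _,
    h1, h2, ?_, fcalc_posSemidef _ ?_, ?_, ?_, fcalc_rank_le _ _, ?_, ?_⟩
  · rw [fcalc_mul_self, fcalc_mul, ← he]
    congr 1
    ext i
    by_cases h : t < e i
    · simp [hφ, h, inv_mul_cancel₀ (ht.trans h).ne']
    · simp [hφ, h]
  · intro i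
    simp only [hψ]
    split_ifs <;> norm_num
  · rw [fcalc_mul, fcalc_smul, fcalc_sub]
    apply fcalc_posSemidef
    intro i
    by_cases h : t < e i
    · have h0 := ht.trans h
      simp only [hφ, h, if_true]
      have : t * (e i)⁻¹ ≤ 1 := by
        rw [← div_eq_mul_inv, div_le_one h0]
        exact h.le
      have h3 : 0 < (e i)⁻¹ := inv_pos.2 h0
      nlinarith
    · simp [hφ, h]
  · rw [fcalc_mul_self, fcalc_mul, ← he, fcalc_smul, fcalc_sub]
    apply fcalc_posSemidef
    intro i
    by_cases h : t < e i
    · simp [hψ, h]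
    · have := not_lt.1 h
      simp [hψ, h, this]
  · simpa using Finset.card_filter_le (Finset.univ : Finset (Fin r)) fun i => φ i ≠ 0
  · rw [fcalc_mul_self, fcalc_mul, ← he, fcalc_trace]
    have hsplit := Finset.card_filter_add_card_filter_not (s := (Finset.univ : Finset (Fin r)))
      (fun i => φ i ≠ 0)
    have hc : ((r : ℝ) - ((Finset.univ.filter fun i => φ i ≠ 0).card : ℝ)) =
        ((Finset.univ.filter fun i => ¬ φ i ≠ 0).card : ℝ) := by
      have : (Finset.univ.filter fun i => φ i ≠ 0).card +
        (Finset.univ.filter fun i => ¬ φ i ≠ 0).card = r := by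
        rw [hsplit, Finset.card_univ, Fintype.card_fin]
      rw [sub_eq_iff_eq_add', ← Nat.cast_add, this]
    rw [hc, ← nsmul_eq_mul, ← Finset.sum_const, Finset.sum_filter]
    apply Finset.sum_le_sum
    intro i _
    by_cases h : t < e i
    · have : φ i ≠ 0 := by simp [hφ, h, (ht.trans h).ne']
      simp [hψ, h, this]
    · have h3 : φ i = 0 := by simp [hφ, h]
      have h4 := hW.eigenvalues_nonneg i
      simp only [hψ, h, h3]
      push Not at h
      simp
      nlinarith

/-! ### The error near the target -/

section orthogonal

variable {ι κ : Type*} [Fintype ι] [Fintype κ] [DecidableEq ι]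

/-- Pythagoras for the splitting of a matrix by an orthogonal projection. -/
lemma norm_sq_split {P : Matrix ι ι ℝ} (hP : Pᵀ = P) (hPP : P * P = P) (B : Matrix ι κ ℝ) :
    ‖B‖ ^ 2 = ‖P * B‖ ^ 2 + ‖(1 - P) * B‖ ^ 2 := by
  have h0 : ip (P * B) ((1 - P) * B) = 0 := by
    rw [ip_mul_left, hP, ← Matrix.mul_assoc, Matrix.mul_sub, hPP]
    simp [ip]
  have := norm_sq_add (P * B) ((1 - P) * B)
  rw [h0, ← Matrix.add_mul] at this
  simpa using this

lemma norm_sq_split_right {P : Matrix ι ι ℝ} (hP : Pᵀ = P) (hPP : P * P = P) (B : Matrix κ ι ℝ) :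
    ‖B‖ ^ 2 = ‖B * P‖ ^ 2 + ‖B * (1 - P)‖ ^ 2 := by
  have h := norm_sq_split hP hPP Bᵀ
  rwa [norm_transpose_frob, ← norm_transpose_frob (P * Bᵀ), ← norm_transpose_frob ((1 - P) * Bᵀ),
    Matrix.transpose_mul, Matrix.transpose_mul, Matrix.transpose_transpose, hP,
    Matrix.transpose_sub, hP, Matrix.transpose_one] at h

/-- The part of a symmetric matrix `E` outside the corner `(1 - P) E (1 - P)`. -/
lemma corner_facts {P E : Matrix ι ι ℝ} (hP : Pᵀ = P) (hPP : P * P = P) (hE : Eᵀ = E) :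
    ‖E‖ ^ 2 = ‖P * E * P‖ ^ 2 + 2 * ‖P * E * (1 - P)‖ ^ 2 + ‖(1 - P) * E * (1 - P)‖ ^ 2 ∧
    ‖(1 - P) * E * P‖ = ‖P * E * (1 - P)‖ ∧
    ip E ((1 - P) * E * (1 - P)) = ‖(1 - P) * E * (1 - P)‖ ^ 2 := by
  have hQ : (1 - P)ᵀ = 1 - P := by rw [Matrix.transpose_sub, hP, Matrix.transpose_one]
  have hQQ : (1 - P) * (1 - P) = 1 - P := by
    rw [Matrix.mul_sub, Matrix.sub_mul, Matrix.sub_mul, hPP]; simp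
  have h2 : ‖(1 - P) * E * P‖ = ‖P * E * (1 - P)‖ := by
    rw [← norm_transpose_frob, Matrix.transpose_mul, Matrix.transpose_mul, hP, hQ, hE,
      Matrix.mul_assoc]
  refine ⟨?_, h2, ?_⟩
  · rw [norm_sq_split hP hPP E, norm_sq_split_right hP hPP (P * E),
      norm_sq_split_right hP hPP ((1 - P) * E), h2]
    ring
  · rw [← ip_self, ip_mul_right _ _ ((1 - P) * E * (1 - P)), ip_mul_left, hQ,
      Matrix.mul_assoc _ (1 - P) (1 - P), hQQ, ← Matrix.mul_assoc, ← Matrix.mul_assoc, hQQ]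

end orthogonal

section iterate

variable {n r : ℕ} {X : Matrix (Fin n) (Fin r) ℝ} {M : Matrix (Fin n) (Fin n) ℝ}
  {Φ Ψ : Matrix (Fin r) (Fin r) ℝ} {t : ℝ}

/-- The spectral projection `X Φ Xᵀ` of `X Xᵀ` onto the eigenvalues above the threshold. -/
lemma lead_proj_facts (hΦ : Φᵀ = Φ) (h1 : Ψ = 1 - Φ * (Xᵀ * X)) (h2 : Ψ = 1 - (Xᵀ * X) * Φ)
    (h3 : Φ * (Xᵀ * X) * Φ = Φ) :
    (X * Φ * Xᵀ)ᵀ = X * Φ * Xᵀ ∧ (X * Φ * Xᵀ) * (X * Φ * Xᵀ) = X * Φ * Xᵀ ∧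
      Xᵀ * (1 - X * Φ * Xᵀ) = Ψ * Xᵀ ∧ (1 - X * Φ * Xᵀ) * X = X * Ψ ∧ Ψ * Ψ = Ψ ∧
      X * Φ * Xᵀ * (X * Ψ * Xᵀ) = 0 := by
  have h4 : (X * Φ * Xᵀ) * (X * Φ * Xᵀ) = X * Φ * Xᵀ := by
    rw [show (X * Φ * Xᵀ) * (X * Φ * Xᵀ) = X * (Φ * (Xᵀ * X) * Φ) * Xᵀ by
      simp only [Matrix.mul_assoc], h3]
  refine ⟨?_, h4, ?_, ?_, ?_, ?_⟩
  · simp only [Matrix.transpose_mul, Matrix.transpose_transpose, hΦ, Matrix.mul_assoc]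
  · rw [h2]; simp only [Matrix.mul_sub, Matrix.sub_mul, Matrix.mul_assoc, Matrix.mul_one,
      Matrix.one_mul]
  · rw [h1]; simp only [Matrix.mul_sub, Matrix.sub_mul, Matrix.mul_assoc, Matrix.mul_one,
      Matrix.one_mul]
  · have : Φ * (Xᵀ * X) * (Φ * (Xᵀ * X)) = Φ * (Xᵀ * X) := by
      rw [← Matrix.mul_assoc, h3]
    rw [h1, Matrix.mul_sub, Matrix.sub_mul, Matrix.sub_mul, this]; simp
  · rw [show X * Φ * Xᵀ * (X * Ψ * Xᵀ) = X * (Φ * (Xᵀ * X) * Ψ) * Xᵀ by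
      simp only [Matrix.mul_assoc], h1, Matrix.mul_sub, ← Matrix.mul_assoc _ Φ, h3]
    simp

/-- On the orthogonal complement of the leading eigenspaces, `X Xᵀ` is at most the threshold. -/
lemma tail_ip_le (hΨt : Ψᵀ = Ψ)
    (hpsd : (t • Ψ - Ψ * (Xᵀ * X) * Ψ).PosSemidef)
    (w : Matrix (Fin n) (Fin 1) ℝ) (ht : 0 ≤ t) :
    ip w (X * Ψ * Xᵀ * w) ≤ t * ‖w‖ ^ 2 := by
  set N := X * Ψ * Xᵀ with hN
  have hNt : Nᵀ = N := by
    simp only [hN, Matrix.transpose_mul, Matrix.transpose_transpose, hΨt, Matrix.mul_assoc]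
  have h1 : ‖N * w‖ ^ 2 ≤ t * ip w (N * w) := by
    have h := ip_conj_nonneg hpsd (Xᵀ * w)
    rw [Matrix.sub_mul, ip_sub_right, Matrix.smul_mul, ip_smul_right] at h
    have e1 : ip (Xᵀ * w) (Ψ * (Xᵀ * w)) = ip w (N * w) := by
      rw [ip_mul_left, Matrix.transpose_transpose, hN]; simp only [Matrix.mul_assoc]
    have e2 : ip (Xᵀ * w) (Ψ * (Xᵀ * X) * Ψ * (Xᵀ * w)) = ‖N * w‖ ^ 2 := by
      rw [ip_mul_left, Matrix.transpose_transpose, ← ip_self, ip_mul_left N, hNt, hN]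
      simp only [Matrix.mul_assoc]
    rw [e1, e2] at h
    linarith
  have h2 := ip_le w (N * w)
  rcases eq_or_lt_of_le (norm_nonneg (N * w)) with h0 | h0
  · rw [← h0] at h2; nlinarith [sq_nonneg ‖w‖]
  · have : ‖N * w‖ ≤ t * ‖w‖ := by
      by_contra! hc
      nlinarith
    nlinarith [norm_nonneg w]

end iterate

/-- The scalar inequality behind `exists_truncation`: `a`, `b`, `u`, `N` are the norms of
`P E (1 - P)`, `(1 - P) M (1 - P)`, `M (1 - P)` and of the tail of `X Xᵀ`. -/
lemma corner_arith {a b u N e l ρ q : ℝ} (hb : 0 ≤ b) (hu0 : 0 ≤ u)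
    (he : 0 ≤ e) (hl : 0 < l) (hq0 : 0 ≤ q) (hq1 : q ≤ 1) (hu : u ^ 2 = a ^ 2 + b ^ 2)
    (hlb : l * b ≤ u ^ 2) (huN : u ≤ N + e) (hN : N ^ 2 ≤ q / 36 * e ^ 2)
    (ha : 2 * a ^ 2 ≤ e ^ 2) (heρ : e ≤ ρ * l) (hρ : ρ ^ 2 * (2 + q) ≤ q) :
    N ^ 2 + b ^ 2 ≤ q / 2 * e ^ 2 := by
  have hNe : N ≤ e / 6 := by
    apply le_of_sq_le_sq _ (by positivity)
    nlinarith [sq_nonneg e]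
  have hue : u ≤ 7 / 6 * (ρ * l) := by linarith
  have hu2 : u ^ 2 ≤ 49 / 36 * ρ ^ 2 * l ^ 2 := by
    have := pow_le_pow_left₀ hu0 hue 2
    nlinarith
  have h1 : l ^ 2 * b ^ 2 ≤ l ^ 2 * (49 / 36 * ρ ^ 2 * u ^ 2) := by
    have h := pow_le_pow_left₀ (by positivity) hlb 2
    have := mul_le_mul_of_nonneg_right hu2 (sq_nonneg u)
    nlinarith
  have h2 : b ^ 2 ≤ 49 / 36 * ρ ^ 2 * u ^ 2 := le_of_mul_le_mul_left h1 (by positivity)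
  have h3 : (2 + q) * b ^ 2 ≤ 49 / 36 * q * u ^ 2 := by
    have := mul_le_mul_of_nonneg_right hρ (sq_nonneg u)
    nlinarith
  have h4 : (2 + q - 49 / 36 * q) * b ^ 2 ≤ 49 / 72 * q * e ^ 2 := by
    rw [hu] at h3
    have := mul_le_mul_of_nonneg_left ha hq0
    nlinarith
  have h5 : 59 / 36 * b ^ 2 ≤ 49 / 72 * q * e ^ 2 := by nlinarith [sq_nonneg b]
  have h6 : 0 ≤ q * e ^ 2 := by positivity
  nlinarith

/-- Near the target, there is a spectral projection `P = X Φ Xᵀ` of `X Xᵀ` such that the error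
`E = X Xᵀ - M` has little mass in the corner `(1 - P) E (1 - P)`, and on whose range `X Xᵀ` is at
least `t₀ ‖E‖`. The threshold is small enough for the eigenvalues below it to contribute little
to `E`. -/
lemma exists_leading_projection {n r rs : ℕ} {X : Matrix (Fin n) (Fin r) ℝ}
    {M E : Matrix (Fin n) (Fin n) ℝ} (hM : M.PosSemidef) (hrank : M.rank = rs) (hE : E = X * Xᵀ - M)
    {l ρ q t₀ : ℝ} (hl0 : 0 < l)
    (hl : ∀ i, hM.isHermitian.eigenvalues i = 0 ∨ l ≤ hM.isHermitian.eigenvalues i)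
    (hE0 : 0 < ‖E‖) (hEρ : ‖E‖ ≤ ρ * l) (hq0 : 0 ≤ q) (hq1 : q ≤ 1) (hρ0 : 0 ≤ ρ)
    (hρ : ρ ^ 2 * (2 + q) ≤ q) (ht0 : 0 < t₀) (ht6 : t₀ ≤ 1 / 6)
    (ht : ((r : ℝ) - rs) * t₀ ^ 2 ≤ q / 36) :
    ∃ Φ : Matrix (Fin r) (Fin r) ℝ, Φᵀ = Φ ∧ Φ * (Xᵀ * X) = (Xᵀ * X) * Φ ∧ Φ * (Xᵀ * X) * Φ = Φ ∧
      (Φ - (t₀ * ‖E‖) • (Φ * Φ)).PosSemidef ∧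
      ‖(1 - X * Φ * Xᵀ) * E * (1 - X * Φ * Xᵀ)‖ ^ 2 ≤ q / 2 * ‖E‖ ^ 2 := by
  set e := ‖E‖ with he
  set t := t₀ * e with htdef
  have htpos : 0 < t := by positivity
  have hW : (Xᵀ * X).PosSemidef := by
    have := Matrix.posSemidef_conjTranspose_mul_self X
    rwa [Matrix.conjTranspose_eq_transpose_of_trivial] at this
  obtain ⟨Φ, Ψ, k, hΦ, hΨ1, hΨ2, hΦW, hΨpsd, hΦpsd, hΨW, hrk, hkr, htr⟩ :=
    exists_truncated_inverse hW htpos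
  obtain ⟨hP, hPP, hXQ, hQX, hΨΨ, hPN⟩ := lead_proj_facts hΦ hΨ1 hΨ2 hΦW
  have hΨt : Ψᵀ = Ψ := posSemidef_transpose_eq hΨpsd
  have hMt : Mᵀ = M := posSemidef_transpose_eq hM
  have hEt : Eᵀ = E := by
    rw [hE, Matrix.transpose_sub, hMt, Matrix.transpose_mul, Matrix.transpose_transpose]
  obtain ⟨P, hPdef⟩ : ∃ P, P = X * Φ * Xᵀ := ⟨_, rfl⟩
  obtain ⟨N, hNdef⟩ : ∃ N, N = X * Ψ * Xᵀ := ⟨_, rfl⟩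
  rw [← hPdef] at hP hPP hXQ hQX
  rw [← hPdef, ← hNdef] at hPN
  obtain ⟨Q, hQdef⟩ : ∃ Q, Q = 1 - P := ⟨_, rfl⟩
  rw [← hQdef] at hXQ hQX
  have hQt : Qᵀ = Q := by rw [hQdef, Matrix.transpose_sub, hP, Matrix.transpose_one]
  have hXXQ : X * Xᵀ * Q = N := by rw [Matrix.mul_assoc, hXQ, hNdef, Matrix.mul_assoc]
  have hQN : Q * N = N := by
    rw [hNdef, ← Matrix.mul_assoc, ← Matrix.mul_assoc, hQX, Matrix.mul_assoc X, hΨΨ]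
  have hMQ : M * Q = N - E * Q := by rw [hE, Matrix.sub_mul, hXXQ]; abel
  have hρ1 : ρ ^ 2 ≤ 1 / 3 := by nlinarith [sq_nonneg ρ]
  have hρ2 : ρ ≤ 2 / 3 := by nlinarith
  -- the truncation keeps at least `rank M` eigenvalues
  have hrsk : rs ≤ k := by
    have hPk : P.rank ≤ k := by
      rw [hPdef]
      exact ((Matrix.rank_mul_le_left _ _).trans (Matrix.rank_mul_le_right _ _)).trans hrk
    rw [← hrank]
    refine (rank_le_rank_of_mul_eq_zero (P := P) fun z hz => ?_).trans hPk
    obtain ⟨w, hw⟩ : ∃ w, w = M * z := ⟨_, rfl⟩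
    rw [← hw] at hz ⊢
    have hQw : Q * w = w := by rw [hQdef, Matrix.sub_mul, hz]; simp
    have h1 : l * ‖w‖ ^ 2 ≤ ip w (M * w) := by
      rw [hw]; exact mul_norm_sq_le_ip_range hM hl z
    have h2 : M * w = N * w - E * w := by
      conv_lhs => rw [← hQw]
      rw [← Matrix.mul_assoc, hMQ, Matrix.sub_mul, Matrix.mul_assoc E, hQw]
    have h3 := tail_ip_le hΨt hΨW w htpos.le
    rw [← hNdef] at h3
    have h4 := abs_ip_le w (E * w)
    have h5 := norm_mul_le_frob E w
    rw [h2, ip_sub_right] at h1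
    have h6 : -ip w (E * w) ≤ e * ‖w‖ ^ 2 := by
      have := (abs_le.1 h4).1
      nlinarith [norm_nonneg w]
    have h7 : e + t < l := by
      rw [htdef]
      nlinarith
    have h8 : ‖w‖ ^ 2 = 0 := by
      have : (l - (e + t)) * ‖w‖ ^ 2 ≤ 0 := by nlinarith
      have h9 : 0 < l - (e + t) := by linarith
      exact le_antisymm (nonpos_of_mul_nonpos_right this h9) (sq_nonneg _)
    exact norm_eq_zero.1 (pow_eq_zero_iff two_ne_zero |>.1 h8)
  have hNn : ‖N‖ ^ 2 ≤ q / 36 * e ^ 2 := by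
    have h1 : ‖N‖ ^ 2 = (Ψ * (Xᵀ * X) * (Ψ * (Xᵀ * X))).trace := by
      rw [← ip_self, ip, hNdef]
      simp only [Matrix.transpose_mul, Matrix.transpose_transpose, hΨt, Matrix.mul_assoc]
      rw [Matrix.trace_mul_comm]
      simp only [Matrix.mul_assoc]
    rw [h1]
    refine htr.trans ?_
    have h2 : ((r : ℝ) - k) * t ^ 2 ≤ ((r : ℝ) - rs) * t ^ 2 := by
      gcongr
    have h3 := mul_le_mul_of_nonneg_right ht (sq_nonneg e)
    have h4 : ((r : ℝ) - rs) * t ^ 2 = ((r : ℝ) - rs) * t₀ ^ 2 * e ^ 2 := by rw [htdef]; ring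
    linarith
  obtain ⟨hs1, hs2, hs3⟩ := corner_facts hP hPP hEt
  rw [← hQdef] at hs1 hs2 hs3
  obtain ⟨a, ha⟩ : ∃ a, a = ‖P * E * Q‖ := ⟨_, rfl⟩
  rw [← ha] at hs1 hs2
  have hRpsd : (Q * M * Q).PosSemidef := by
    have := hM.conjTranspose_mul_mul_same Q
    rwa [Matrix.conjTranspose_eq_transpose_of_trivial, hQt] at this
  have hNpsd : N.PosSemidef := by
    have := hΨpsd.mul_mul_conjTranspose_same X
    rwa [Matrix.conjTranspose_eq_transpose_of_trivial, ← hNdef] at this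
  have hQEQ : Q * E * Q = N - Q * M * Q := by
    rw [hE, Matrix.mul_sub, Matrix.sub_mul, Matrix.mul_assoc Q, hXXQ, hQN]
  have hcorner : ‖Q * E * Q‖ ^ 2 ≤ ‖N‖ ^ 2 + ‖Q * M * Q‖ ^ 2 := by
    rw [hQEQ, norm_sq_sub]
    linarith [ip_nonneg_of_posSemidef hNpsd hRpsd]
  have hu : ‖M * Q‖ ^ 2 = a ^ 2 + ‖Q * M * Q‖ ^ 2 := by
    have h1 : ‖P * (M * Q)‖ = a := by
      rw [hMQ, Matrix.mul_sub, hPN, zero_sub, norm_neg, ha, Matrix.mul_assoc]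
    have h2 := norm_sq_split hP hPP (M * Q)
    rwa [← hQdef, h1, ← Matrix.mul_assoc Q] at h2
  have hlb : l * ‖Q * M * Q‖ ≤ ‖M * Q‖ ^ 2 := by
    have h1 := mul_ip_le_norm_sq hM hl Q
    have h2 := norm_le_trace hRpsd
    rw [ip, hQt, ← Matrix.mul_assoc] at h1
    exact (mul_le_mul_of_nonneg_left h2 hl0.le).trans h1
  have huN : ‖M * Q‖ ≤ ‖N‖ + e := by
    rw [hMQ]
    refine (norm_sub_le _ _).trans ?_
    gcongr
    have h1 := norm_sq_split_right hP hPP E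
    rw [← hQdef] at h1
    have h2 := sq_nonneg ‖E * P‖
    exact (sq_le_sq₀ (norm_nonneg _) hE0.le).1 (by linarith only [h1, h2])
  have haE : 2 * a ^ 2 ≤ e ^ 2 := by
    have h1 := sq_nonneg ‖P * E * P‖
    have h2 := sq_nonneg ‖Q * E * Q‖
    linarith only [h1, h2, hs1]
  have hfin := corner_arith (norm_nonneg (Q * M * Q)) (norm_nonneg (M * Q)) hE0.le
    hl0 hq0 hq1 hu hlb huN hNn haE hEρ hρ
  refine ⟨Φ, hΦ, sub_right_injective (hΨ1.symm.trans hΨ2), hΦW, hΦpsd, ?_⟩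
  rw [← hPdef, ← hQdef]
  linarith only [hfin, hcorner]

/-- Near the target, the error `E = X Xᵀ - M` makes a small angle with the symmetric perturbations
`V Xᵀ + X Vᵀ` of `X Xᵀ`, even with those `V` for which `t₀ ‖E‖ ‖V‖² ≤ ‖V Xᵀ‖²`. The direction is
`V = (1 - P / 2) E X Φ`, for which `V Xᵀ + X Vᵀ` is the part of `E` outside the corner
`(1 - P) E (1 - P)`. That the columns of `V` lie in the span of those of `X` and `M` keeps the rank
low enough for the restricted isometry property. -/
lemma exists_truncation {n r rs : ℕ} {X : Matrix (Fin n) (Fin r) ℝ}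
    {M E : Matrix (Fin n) (Fin n) ℝ} (hM : M.PosSemidef) (hrank : M.rank = rs) (hE : E = X * Xᵀ - M)
    {l ρ q t₀ : ℝ} (hl0 : 0 < l)
    (hl : ∀ i, hM.isHermitian.eigenvalues i = 0 ∨ l ≤ hM.isHermitian.eigenvalues i)
    (hE0 : 0 < ‖E‖) (hEρ : ‖E‖ ≤ ρ * l) (hq0 : 0 ≤ q) (hq1 : q ≤ 1) (hρ0 : 0 ≤ ρ)
    (hρ : ρ ^ 2 * (2 + q) ≤ q) (ht0 : 0 < t₀) (ht6 : t₀ ≤ 1 / 6)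
    (ht : ((r : ℝ) - rs) * t₀ ^ 2 ≤ q / 36) :
    ∃ V : Matrix (Fin n) (Fin r) ℝ,
      (∃ (B₁ : Matrix (Fin r) (Fin r) ℝ) (B₂ : Matrix (Fin n) (Fin r) ℝ), V = X * B₁ + M * B₂) ∧
      ip E (V * Xᵀ + X * Vᵀ) = ‖V * Xᵀ + X * Vᵀ‖ ^ 2 ∧
      (1 - q / 2) * ‖E‖ ^ 2 ≤ ‖V * Xᵀ + X * Vᵀ‖ ^ 2 ∧
      ‖V * Xᵀ‖ ^ 2 ≤ 1 / 2 * ‖V * Xᵀ + X * Vᵀ‖ ^ 2 ∧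
      t₀ * ‖E‖ * ‖V‖ ^ 2 ≤ ‖V * Xᵀ‖ ^ 2 := by
  obtain ⟨Φ, hΦ, hcomm, hΦW, hΦpsd, hcorner⟩ :=
    exists_leading_projection hM hrank hE hl0 hl hE0 hEρ hq0 hq1 hρ0 hρ ht0 ht6 ht
  have hMt : Mᵀ = M := posSemidef_transpose_eq hM
  have hEt : Eᵀ = E := by
    rw [hE, Matrix.transpose_sub, hMt, Matrix.transpose_mul, Matrix.transpose_transpose]
  obtain ⟨hP, hPP, -⟩ := lead_proj_facts hΦ rfl (by rw [hcomm]) hΦW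
  obtain ⟨P, hPdef⟩ : ∃ P, P = X * Φ * Xᵀ := ⟨_, rfl⟩
  rw [← hPdef] at hP hPP hcorner
  obtain ⟨hs1, hs2, hs3⟩ := corner_facts hP hPP hEt
  obtain ⟨Q, hQdef⟩ : ∃ Q, Q = 1 - P := ⟨_, rfl⟩
  rw [← hQdef] at hs1 hs2 hs3 hcorner
  obtain ⟨a, ha⟩ : ∃ a, a = ‖P * E * Q‖ := ⟨_, rfl⟩
  rw [← ha] at hs1 hs2
  obtain ⟨F, hF⟩ : ∃ F, F = (1 - (1 / 2 : ℝ) • P) * E := ⟨_, rfl⟩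
  have hVX : F * X * Φ * Xᵀ = F * P := by rw [hPdef]; simp only [Matrix.mul_assoc]
  have hY : F * X * Φ * Xᵀ + X * (F * X * Φ)ᵀ = E - Q * E * Q := by
    have : X * (F * X * Φ)ᵀ = (F * P)ᵀ := by
      rw [← hVX]; simp only [Matrix.transpose_mul, Matrix.transpose_transpose]
    rw [this, hVX, hF, Matrix.transpose_mul, Matrix.transpose_mul, hP, hEt, Matrix.transpose_sub,
      Matrix.transpose_smul, hP, Matrix.transpose_one, hQdef]
    simp only [Matrix.sub_mul, Matrix.mul_sub, Matrix.one_mul, Matrix.mul_one, Matrix.smul_mul,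
      Matrix.mul_smul, Matrix.mul_assoc]
    module
  have hYn : ‖E - Q * E * Q‖ ^ 2 = ‖E‖ ^ 2 - ‖Q * E * Q‖ ^ 2 := by
    rw [norm_sq_sub, hs3]; ring
  refine ⟨F * X * Φ, ⟨Xᵀ * X * Φ - (1 / 2 : ℝ) • (Φ * Xᵀ * E * X * Φ), -(X * Φ), ?_⟩,
    ?_, ?_, ?_, ?_⟩
  · rw [hF, Matrix.sub_mul, Matrix.one_mul, Matrix.sub_mul, Matrix.sub_mul]
    conv_lhs => enter [1]; rw [hE]
    rw [hPdef]
    simp only [Matrix.sub_mul, Matrix.mul_sub, Matrix.mul_neg, Matrix.smul_mul,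
      Matrix.mul_smul, Matrix.mul_assoc]
    abel
  · rw [hY, hYn, ip_sub_right, hs3, ip_self]
  · rw [hY, hYn]
    nlinarith
  · have h1 : ‖F * P‖ ^ 2 = 1 / 4 * ‖P * E * P‖ ^ 2 + a ^ 2 := by
      rw [norm_sq_split hP hPP (F * P), ← hQdef, ← hs2]
      have e1 : P * (F * P) = (1 / 2 : ℝ) • (P * E * P) := by
        rw [hF, ← Matrix.mul_assoc, ← Matrix.mul_assoc, Matrix.mul_sub, Matrix.mul_smul, hPP,
          Matrix.mul_one, Matrix.sub_mul, Matrix.sub_mul, Matrix.smul_mul, Matrix.smul_mul]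
        module
      have e2 : Q * (F * P) = Q * E * P := by
        have hQP : Q * P = 0 := by rw [hQdef, Matrix.sub_mul, hPP]; simp
        rw [hF, ← Matrix.mul_assoc, ← Matrix.mul_assoc, Matrix.mul_sub, Matrix.mul_smul, hQP,
          Matrix.mul_one, smul_zero, sub_zero]
      rw [e1, e2, norm_smul, mul_pow]
      norm_num
    rw [hY, hYn, hVX, h1]
    nlinarith [sq_nonneg ‖P * E * P‖]
  · have h := ip_conj_nonneg hΦpsd (F * X)ᵀ
    rw [Matrix.sub_mul, ip_sub_right, Matrix.smul_mul, ip_smul_right] at h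
    have e1 : ip (F * X)ᵀ (Φ * (F * X)ᵀ) = ‖F * X * Φ * Xᵀ‖ ^ 2 := by
      set G := F * X
      have h5 : G * Φ * Xᵀ * Xᵀᵀ * Φᵀ = G * Φ := by
        rw [Matrix.transpose_transpose, hΦ]
        conv_rhs => rw [← hΦW]
        simp only [Matrix.mul_assoc]
      rw [← ip_self, ip_mul_right (G * Φ) Xᵀ, ip_mul_right G Φ, h5, ← ip_transpose G,
        Matrix.transpose_mul G, hΦ]
    have e2 : ip (F * X)ᵀ (Φ * Φ * (F * X)ᵀ) = ‖F * X * Φ‖ ^ 2 := by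
      rw [← norm_transpose_frob, ← ip_self, Matrix.transpose_mul (F * X) Φ, hΦ, ip_mul_left, hΦ,
        Matrix.mul_assoc]
    rw [e1, e2] at h
    linarith

/-! ### The measurement operator and restricted isometry -/

section rip

variable {n m : ℕ} (A : Fin m → Matrix (Fin n) (Fin n) ℝ)

lemma sense_add (M N : Matrix (Fin n) (Fin n) ℝ) : sense A (M + N) = sense A M + sense A N := by
  ext i; simp [sense, Matrix.mul_add]

lemma sense_smul (a : ℝ) (M : Matrix (Fin n) (Fin n) ℝ) : sense A (a • M) = a • sense A M := by
  ext i; simp [sense]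

lemma sense_sub (M N : Matrix (Fin n) (Fin n) ℝ) : sense A (M - N) = sense A M - sense A N := by
  ext i; simp [sense, Matrix.mul_sub]

/-- The bilinear form `(1/m) ⟨𝒜(M), 𝒜(N)⟩`. -/
def senseForm (M N : Matrix (Fin n) (Fin n) ℝ) : ℝ :=
  1 / (m : ℝ) * inner ℝ (sense A M) (sense A N)

lemma senseForm_self (M : Matrix (Fin n) (Fin n) ℝ) :
    senseForm A M M = 1 / (m : ℝ) * ‖sense A M‖ ^ 2 := by
  rw [senseForm, real_inner_self_eq_norm_sq]

lemma senseForm_comm (M N : Matrix (Fin n) (Fin n) ℝ) : senseForm A M N = senseForm A N M := by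
  rw [senseForm, senseForm, real_inner_comm]

lemma senseForm_add_left (M N L : Matrix (Fin n) (Fin n) ℝ) :
    senseForm A (M + N) L = senseForm A M L + senseForm A N L := by
  rw [senseForm, senseForm, senseForm, sense_add, inner_add_left, mul_add]

lemma senseForm_smul_left (a : ℝ) (M L : Matrix (Fin n) (Fin n) ℝ) :
    senseForm A (a • M) L = a * senseForm A M L := by
  rw [senseForm, senseForm, sense_smul, real_inner_smul_left]; ring

lemma senseForm_add_right (M N L : Matrix (Fin n) (Fin n) ℝ) :
    senseForm A L (M + N) = senseForm A L M + senseForm A L N := by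
  rw [senseForm_comm, senseForm_add_left, senseForm_comm, senseForm_comm A N]

lemma senseForm_smul_right (a : ℝ) (M L : Matrix (Fin n) (Fin n) ℝ) :
    senseForm A L (a • M) = a * senseForm A L M := by
  rw [senseForm_comm, senseForm_smul_left, senseForm_comm]

variable {A} {k : ℕ} {δ : ℝ}

lemma RIP.senseForm_self_bounds (h : RIP A k δ) {M : Matrix (Fin n) (Fin n) ℝ} (hM : Mᵀ = M)
    (hr : M.rank ≤ k) :
    (1 - δ) * ‖M‖ ^ 2 ≤ senseForm A M M ∧ senseForm A M M ≤ (1 + δ) * ‖M‖ ^ 2 := by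
  rw [senseForm_self]; exact h M hM hr

lemma RIP.abs_senseForm_le (h : RIP A k δ) (hδ : 0 ≤ δ) {M N : Matrix (Fin n) (Fin n) ℝ}
    (hM : Mᵀ = M) (hMr : M.rank ≤ k) (hN : Nᵀ = N) (hNr : N.rank ≤ k) :
    |senseForm A M N| ≤ (1 + δ) * ‖M‖ * ‖N‖ := by
  have h1 := (h.senseForm_self_bounds hM hMr).2
  have h2 := (h.senseForm_self_bounds hN hNr).2
  have hm : 0 ≤ 1 / (m : ℝ) := by positivity
  have h3 : |senseForm A M N| ≤ 1 / (m : ℝ) * (‖sense A M‖ * ‖sense A N‖) := by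
    rw [senseForm, abs_mul, abs_of_nonneg hm]
    exact mul_le_mul_of_nonneg_left (abs_real_inner_le_norm _ _) hm
  refine h3.trans (abs_le_of_sq_le_sq' ?_ (by positivity)).2
  rw [senseForm_self] at h1 h2
  calc (1 / (m : ℝ) * (‖sense A M‖ * ‖sense A N‖)) ^ 2
      = (1 / (m : ℝ) * ‖sense A M‖ ^ 2) * (1 / (m : ℝ) * ‖sense A N‖ ^ 2) := by ring
    _ ≤ ((1 + δ) * ‖M‖ ^ 2) * ((1 + δ) * ‖N‖ ^ 2) := by gcongr
    _ = ((1 + δ) * ‖M‖ * ‖N‖) ^ 2 := by ring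

/-- Polarization of the restricted isometry property. -/
lemma RIP.le_senseForm (h : RIP A k δ) {M N : Matrix (Fin n) (Fin n) ℝ}
    (hM : Mᵀ = M) (hN : Nᵀ = N) (hr : ∀ a b : ℝ, (a • M + b • N).rank ≤ k) :
    ip M N - δ * ‖M‖ * ‖N‖ ≤ senseForm A M N := by
  have hs : ∀ a b : ℝ, (a • M + b • N)ᵀ = a • M + b • N := by
    intro a b
    rw [Matrix.transpose_add, Matrix.transpose_smul, Matrix.transpose_smul, hM, hN]
  rcases eq_or_ne M 0 with rfl | hM0
  · have := senseForm_smul_left A 0 0 N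
    simp [ip] at this ⊢
    exact this.ge
  rcases eq_or_ne N 0 with rfl | hN0
  · have := senseForm_smul_right A 0 0 M
    simp [ip] at this ⊢
    exact this.ge
  have hMp : 0 < ‖M‖ := norm_pos_iff.2 hM0
  have hNp : 0 < ‖N‖ := norm_pos_iff.2 hN0
  -- the two matrices are scaled to the same norm before polarizing
  have h1 := (h.senseForm_self_bounds (hs ‖N‖ ‖M‖) (hr _ _)).1
  have h2 := (h.senseForm_self_bounds (hs ‖N‖ (-‖M‖)) (hr _ _)).2
  simp only [norm_sq_add, senseForm_add_left, senseForm_add_right, senseForm_smul_left,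
    senseForm_smul_right, ip_smul_left, ip_smul_right, norm_smul, norm_norm, norm_neg,
    senseForm_comm A N M] at h1 h2
  have h3 : 0 ≤ (‖M‖ * ‖N‖) * (senseForm A M N - (ip M N - δ * ‖M‖ * ‖N‖)) := by
    nlinarith
  have := nonneg_of_mul_nonneg_right h3 (by positivity)
  linarith

end rip

lemma rank_add_le_add {n r : ℕ} (B C : Matrix (Fin n) (Fin r) ℝ) :
    (B + C).rank ≤ B.rank + C.rank := by
  unfold Matrix.rank
  rw [Matrix.mulVecLin_add]
  refine le_trans ?_ (Submodule.finrank_add_le_finrank_add_finrank _ _)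
  exact Submodule.finrank_mono (LinearMap.range_add_le _ _)

lemma rank_mul_add_mul_le {n r k : ℕ} (X : Matrix (Fin n) (Fin r) ℝ) (M : Matrix (Fin n) (Fin n) ℝ)
    (B : Matrix (Fin r) (Fin k) ℝ) (C : Matrix (Fin n) (Fin k) ℝ) :
    (X * B + M * C).rank ≤ r + M.rank := by
  refine (rank_add_le_add _ _).trans (add_le_add ?_ (Matrix.rank_mul_le_left _ _))
  exact (Matrix.rank_mul_le_left _ _).trans (by simpa using Matrix.rank_le_width X)

lemma rank_sym_prod_le {n r : ℕ} (X V : Matrix (Fin n) (Fin r) ℝ) :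
    (V * Xᵀ + X * Vᵀ).rank ≤ 2 * r := by
  refine (rank_add_le_add _ _).trans ?_
  have h1 := (Matrix.rank_mul_le_left V Xᵀ).trans (Matrix.rank_le_width V)
  have h2 := (Matrix.rank_mul_le_left X Vᵀ).trans (Matrix.rank_le_width X)
  omega

lemma rank_error_le {n r : ℕ} (X : Matrix (Fin n) (Fin r) ℝ) {M : Matrix (Fin n) (Fin n) ℝ}
    (hM : M.rank ≤ r) : (X * Xᵀ - M).rank ≤ 2 * r := by
  have := rank_mul_add_mul_le X M Xᵀ (-1)
  rw [show X * Xᵀ + M * (-1) = X * Xᵀ - M by simp [sub_eq_add_neg]] at this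
  omega

/-! ### Gradient dominance -/

/-- The squared norm `tr(V (Xᵀ X + η I) Vᵀ)` induced by the preconditioner. -/
def precSq {n r : ℕ} (X : Matrix (Fin n) (Fin r) ℝ) (η : ℝ) (V : Matrix (Fin n) (Fin r) ℝ) : ℝ :=
  ‖V * Xᵀ‖ ^ 2 + η * ‖V‖ ^ 2

lemma precSq_nonneg {n r : ℕ} (X : Matrix (Fin n) (Fin r) ℝ) {η : ℝ} (hη : 0 ≤ η)
    (V : Matrix (Fin n) (Fin r) ℝ) : 0 ≤ precSq X η V := by
  unfold precSq; positivity

lemma cosine_gap_pos {δ : ℝ} (hδ : 0 ≤ δ) (hδ1 : δ < 1) : 0 < √((1 + δ ^ 2) / 2) - δ := by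
  rw [sub_pos]
  apply Real.lt_sqrt_of_sq_lt
  nlinarith

lemma muP_pos {δ c : ℝ} (hδ : 0 ≤ δ) (hδ1 : δ < 1) (hc : 0 ≤ c) (r rs : ℕ) : 0 < muP δ c r rs := by
  have := cosine_gap_pos hδ hδ1
  have h2 : 1 < √2 := by
    rw [Real.lt_sqrt] <;> norm_num
  have h3 : 0 < √2 - 1 := by linarith
  unfold muP
  positivity

lemma muP_le_one {δ c : ℝ} (hδ : 0 ≤ δ) (hδ1 : δ < 1) (hc : 0 ≤ c) (r rs : ℕ) :
    muP δ c r rs ≤ 1 := by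
  have h0 := cosine_gap_pos hδ hδ1
  have h1 : √((1 + δ ^ 2) / 2) ≤ 1 := by
    rw [Real.sqrt_le_iff]; constructor <;> nlinarith
  have h2 : 1 < √2 := by
    rw [Real.lt_sqrt] <;> norm_num
  have h3 : 0 < √2 - 1 := by linarith
  unfold muP
  have h4 : min (1 + c / (√2 - 1))⁻¹ (1 + 3 * c * √(((r : ℝ) - rs) / (1 - δ ^ 2)))⁻¹ ≤ 1 := by
    refine (min_le_left _ _).trans (inv_le_one_of_one_le₀ ?_)
    have : 0 ≤ c / (√2 - 1) := by positivity
    linarith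
  have h5 : (√((1 + δ ^ 2) / 2) - δ) ^ 2 ≤ 1 := pow_le_one₀ h0.le (by linarith)
  exact mul_le_one₀ h5 (by positivity) h4

/-- The constant `μ_P` leaves a factor `4` for the eigenvalue threshold
`t₀ = 1 / (6 max(1, √((r - r⋆) / (1 - δ²))))`. -/
lemma muP_mul_le {δ : ℝ} (r rs : ℕ) {x : ℝ}
    (hx : x ≤ 9 * √(1 + δ) * max 1 √(((r : ℝ) - rs) / (1 - δ ^ 2))) :
    muP δ √(1 + δ) r rs * (1 + x) ≤ 4 * (√((1 + δ ^ 2) / 2) - δ) ^ 2 := by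
  set s := √(((r : ℝ) - rs) / (1 - δ ^ 2))
  set c := √(1 + δ)
  have hc : 0 ≤ c := Real.sqrt_nonneg _
  have hs : 0 ≤ s := Real.sqrt_nonneg _
  have h2 : 5 / 4 < √2 := by
    rw [Real.lt_sqrt] <;> norm_num
  have h22 : √2 * √2 = 2 := Real.mul_self_sqrt (by norm_num)
  have h3 : 0 < √2 - 1 := by linarith
  have h4 : c / (√2 - 1) = c * (√2 + 1) := by
    rw [div_eq_iff h3.ne']; nlinarith
  have hmin : min (1 + c / (√2 - 1))⁻¹ (1 + 3 * c * s)⁻¹ * (1 + x) ≤ 4 := by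
    rcases le_total (1 + x) 0 with hx0 | hx0
    · exact (mul_nonpos_of_nonneg_of_nonpos (by positivity) hx0).trans (by norm_num)
    rcases le_total 1 s with h1 | h1
    · rw [max_eq_right h1] at hx
      refine (mul_le_mul_of_nonneg_right (min_le_right _ _) hx0).trans ?_
      rw [inv_mul_le_iff₀ (by positivity)]
      nlinarith [mul_nonneg hc hs]
    · rw [max_eq_left h1] at hx
      refine (mul_le_mul_of_nonneg_right (min_le_left _ _) hx0).trans ?_
      rw [inv_mul_le_iff₀ (by positivity), h4]
      nlinarith
  unfold muP
  rw [mul_assoc, mul_comm (4 : ℝ)]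
  exact mul_le_mul_of_nonneg_left hmin (sq_nonneg _)

/-- Gradient dominance of the noiseless loss near the target, in terms of a direction `V`: the
left-hand side of the inequality is `√(2 μ_P) ‖E‖` times the length of `V`, the right-hand side
the derivative of the loss along `V`. -/
lemma exists_ascent_direction {n m r rs : ℕ} {A : Fin m → Matrix (Fin n) (Fin n) ℝ}
    {M : Matrix (Fin n) (Fin n) ℝ} {X : Matrix (Fin n) (Fin r) ℝ} {δ ρ η : ℝ}
    (hM : M.PosSemidef) (hrank : M.rank = rs) (hrs : rs ≤ r) (hδ : 0 ≤ δ) (hδ1 : δ < 1)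
    (hA : RIP A (2 * r) δ) (hρ0 : 0 < ρ) (hρ1 : ρ < 1)
    (hρ : ρ ^ 2 / (1 - ρ ^ 2) ≤ (1 - δ ^ 2) / 2) (hE0 : 0 < ‖X * Xᵀ - M‖)
    (hEρ : ‖X * Xᵀ - M‖ ≤ ρ * lam hM.isHermitian rs) (hη : 0 ≤ η)
    (hηE : η ≤ 3 / 2 * √(1 + δ) * ‖X * Xᵀ - M‖) :
    ∃ V : Matrix (Fin n) (Fin r) ℝ, 0 < precSq X η V ∧
      √(2 * muP δ √(1 + δ) r rs) * ‖X * Xᵀ - M‖ * √(precSq X η V) ≤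
        2 * senseForm A (X * Xᵀ - M) (V * Xᵀ + X * Vᵀ) := by
  obtain ⟨E, hE⟩ : ∃ E, E = X * Xᵀ - M := ⟨_, rfl⟩
  rw [← hE] at hE0 hEρ hηE ⊢
  set q := 1 - δ ^ 2 with hq
  have hq0 : 0 < q := by nlinarith
  have hq1 : q ≤ 1 := by nlinarith [sq_nonneg δ]
  have hρq : ρ ^ 2 * (2 + q) ≤ q := by
    have h1 : 0 < 1 - ρ ^ 2 := by nlinarith
    rw [div_le_iff₀ h1] at hρ
    nlinarith
  have hl0 : 0 < lam hM.isHermitian rs := by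
    by_contra! h
    nlinarith
  set s := √(((r : ℝ) - rs) / q) with hs
  set mx := max 1 s with hmx
  have hmx1 : 1 ≤ mx := le_max_left _ _
  have hmx0 : 0 < mx := by linarith
  have hrs' : (0 : ℝ) ≤ (r : ℝ) - rs := by
    have : (rs : ℝ) ≤ r := by exact_mod_cast hrs
    linarith
  set t₀ := 1 / (6 * mx) with ht₀
  have ht0 : 0 < t₀ := by positivity
  have ht6 : t₀ ≤ 1 / 6 := by
    rw [ht₀]
    exact one_div_le_one_div_of_le (by norm_num) (by linarith)
  have ht : ((r : ℝ) - rs) * t₀ ^ 2 ≤ q / 36 := by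
    have h1 : s ^ 2 ≤ mx ^ 2 := pow_le_pow_left₀ (Real.sqrt_nonneg _) (le_max_right _ _) 2
    rw [hs, Real.sq_sqrt (by positivity), div_le_iff₀ hq0] at h1
    rw [ht₀, div_pow, mul_pow, ← mul_div_assoc, div_le_div_iff₀ (by positivity) (by norm_num)]
    nlinarith
  obtain ⟨V, ⟨B₁, B₂, hV⟩, h1, h2, h3, h4⟩ := exists_truncation hM hrank hE hl0
    (eigenvalues_eq_zero_or_lam_le hM hrank) hE0 hEρ hq0.le hq1 hρ0.le hρq ht0 ht6 ht
  refine ⟨V, ?_⟩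
  obtain ⟨Y, hY⟩ : ∃ Y, Y = V * Xᵀ + X * Vᵀ := ⟨_, rfl⟩
  rw [← hY] at h1 h2 h3 ⊢
  have hEt : Eᵀ = E := by
    rw [hE, Matrix.transpose_sub, posSemidef_transpose_eq hM, Matrix.transpose_mul,
      Matrix.transpose_transpose]
  have hYt : Yᵀ = Y := by
    rw [hY, Matrix.transpose_add, Matrix.transpose_mul, Matrix.transpose_mul,
      Matrix.transpose_transpose, Matrix.transpose_transpose, add_comm]
  have hYX : ‖Y‖ ≤ 2 * ‖V * Xᵀ‖ := by
    rw [hY]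
    refine (norm_add_le _ _).trans (le_of_eq ?_)
    rw [← norm_transpose_frob (X * Vᵀ), Matrix.transpose_mul, Matrix.transpose_transpose]
    ring
  -- `E` and `Y` live on the span of the columns of `X` and of `M`
  have hrk : ∀ a b : ℝ, (a • E + b • Y).rank ≤ 2 * r := by
    intro a b
    have : a • E + b • Y =
        X * (a • Xᵀ + b • (B₁ * Xᵀ) + b • Vᵀ) + M * (b • (B₂ * Xᵀ) - a • 1) := by
      rw [hE, hY]
      conv_lhs => enter [2, 2, 1]; rw [hV]
      simp only [Matrix.mul_add, Matrix.add_mul, Matrix.mul_sub, Matrix.mul_smul, smul_sub,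
        smul_add, Matrix.mul_one, Matrix.mul_assoc]
      abel
    rw [this]
    have := rank_mul_add_mul_le X M (a • Xᵀ + b • (B₁ * Xᵀ) + b • Vᵀ) (b • (B₂ * Xᵀ) - a • 1)
    omega
  have h5 := hA.le_senseForm hEt hYt hrk
  rw [h1] at h5
  set e := ‖E‖ with he
  set y := ‖Y‖ with hy
  set c₀ := √((1 + δ ^ 2) / 2) - δ with hc₀
  have hc₀p : 0 < c₀ := cosine_gap_pos hδ hδ1
  have hye : √((1 + δ ^ 2) / 2) * e ≤ y := by
    apply (sq_le_sq₀ (by positivity) (norm_nonneg _)).1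
    rw [mul_pow, Real.sq_sqrt (by positivity)]
    refine le_trans (le_of_eq ?_) h2
    rw [hq]; ring
  have hy0 : 0 < y := lt_of_lt_of_le (by positivity) hye
  have hVX : 0 < ‖V * Xᵀ‖ := by linarith
  have h6 : 2 * (y * c₀ * e) ≤ 2 * senseForm A E Y := by
    have : y * c₀ * e ≤ y ^ 2 - δ * e * y := by
      rw [hc₀]
      nlinarith
    linarith
  have hx : η / (t₀ * e) ≤ 9 * √(1 + δ) * mx := by
    rw [div_le_iff₀ (by positivity)]
    refine hηE.trans (le_of_eq ?_)
    rw [ht₀]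
    field_simp
    ring
  have h7 := muP_mul_le r rs hx
  have h8 : precSq X η V ≤ 1 / 2 * y ^ 2 * (1 + η / (t₀ * e)) := by
    have e1 : η * ‖V‖ ^ 2 ≤ η / (t₀ * e) * ‖V * Xᵀ‖ ^ 2 := by
      rw [div_mul_eq_mul_div, le_div_iff₀ (by positivity), mul_assoc, mul_comm (‖V‖ ^ 2)]
      exact mul_le_mul_of_nonneg_left h4 hη
    have e2 : 0 ≤ η / (t₀ * e) := by positivity
    have e3 := mul_le_mul_of_nonneg_left h3 (by positivity : 0 ≤ 1 + η / (t₀ * e))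
    unfold precSq
    linarith only [e1, e3]
  refine ⟨by unfold precSq; positivity, ?_⟩
  refine le_trans ?_ h6
  apply (sq_le_sq₀ (by positivity) (by positivity)).1
  have hμ := muP_pos hδ hδ1 (Real.sqrt_nonneg (1 + δ)) r rs
  rw [mul_pow, mul_pow, Real.sq_sqrt (by positivity), Real.sq_sqrt (precSq_nonneg X hη V)]
  calc 2 * muP δ √(1 + δ) r rs * e ^ 2 * precSq X η V
      ≤ 2 * muP δ √(1 + δ) r rs * e ^ 2 * (1 / 2 * y ^ 2 * (1 + η / (t₀ * e))) := by gcongr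
    _ = (muP δ √(1 + δ) r rs * (1 + η / (t₀ * e))) * (y ^ 2 * e ^ 2) := by ring
    _ ≤ (4 * c₀ ^ 2) * (y ^ 2 * e ^ 2) := by gcongr
    _ = (2 * (y * c₀ * e)) ^ 2 := by ring

/-! ### The gradient of the empirical loss -/

section gradient

variable {n m r : ℕ} (A : Fin m → Matrix (Fin n) (Fin n) ℝ)

lemma outer_add (X V : Matrix (Fin n) (Fin r) ℝ) (t : ℝ) :
    (X + t • V) * (X + t • V)ᵀ = X * Xᵀ + t • (V * Xᵀ + X * Vᵀ) + t ^ 2 • (V * Vᵀ) := by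
  rw [Matrix.transpose_add, Matrix.transpose_smul]
  simp only [Matrix.add_mul, Matrix.mul_add, Matrix.smul_mul, Matrix.mul_smul, smul_add, smul_smul,
    sq]
  abel

lemma lineDeriv_loss (y : EuclideanSpace ℝ (Fin m)) (X V : Matrix (Fin n) (Fin r) ℝ) :
    lineDeriv ℝ (loss A y) X V =
      -2 * (1 / (m : ℝ) * inner ℝ (y - sense A (X * Xᵀ)) (sense A (V * Xᵀ + X * Vᵀ))) := by
  set a := y - sense A (X * Xᵀ) with ha
  set b := sense A (V * Xᵀ + X * Vᵀ) with hb
  set c := sense A (V * Vᵀ) with hc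
  have h1 : (fun t : ℝ => loss A y (X + t • V)) =
      fun t : ℝ => 1 / (m : ℝ) * ‖a - t • b - t ^ 2 • c‖ ^ 2 := by
    ext t
    rw [loss, outer_add, sense_add, sense_add, sense_smul, sense_smul, ← hb, ← hc, ha]
    congr 3
    abel
  have h2 : HasDerivAt (fun t : ℝ => a - t • b - t ^ 2 • c)
      (-((1 : ℝ) • b) - ((2 : ℕ) * (0 : ℝ) ^ (2 - 1) : ℝ) • c) 0 :=
    (((hasDerivAt_id (0 : ℝ)).smul_const b).const_sub a).sub
      ((hasDerivAt_pow 2 (0 : ℝ)).smul_const c)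
  have h3 := (h2.norm_sq).const_mul (1 / (m : ℝ))
  rw [lineDeriv, h1, h3.deriv]
  simp [inner_neg_right]
  ring

/-- The gradient represents the derivative of the loss with respect to the trace inner product. -/
lemma ip_matGrad_loss (y : EuclideanSpace ℝ (Fin m)) (X V : Matrix (Fin n) (Fin r) ℝ) :
    ip (matGrad (loss A y) X) V =
      -2 * (1 / (m : ℝ) * inner ℝ (y - sense A (X * Xᵀ)) (sense A (V * Xᵀ + X * Vᵀ))) := by
  let φ : Matrix (Fin n) (Fin r) ℝ →ₗ[ℝ] ℝ :=
    { toFun := fun V => -2 * (1 / (m : ℝ) *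
        inner ℝ (y - sense A (X * Xᵀ)) (sense A (V * Xᵀ + X * Vᵀ)))
      map_add' := by
        intro V W
        rw [show (V + W) * Xᵀ + X * (V + W)ᵀ = (V * Xᵀ + X * Vᵀ) + (W * Xᵀ + X * Wᵀ) by
          rw [Matrix.transpose_add, Matrix.add_mul, Matrix.mul_add]; abel, sense_add,
          inner_add_right]
        ring
      map_smul' := by
        intro c V
        rw [show (c • V) * Xᵀ + X * (c • V)ᵀ = c • (V * Xᵀ + X * Vᵀ) by
          rw [Matrix.transpose_smul, Matrix.smul_mul, Matrix.mul_smul, smul_add], sense_smul,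
          real_inner_smul_right]
        simp only [smul_eq_mul, RingHom.id_apply]
        ring }
  have hφ : ∀ V, φ V = lineDeriv ℝ (loss A y) X V := fun V => (lineDeriv_loss A y X V).symm
  change _ = φ V
  conv_rhs => rw [Matrix.matrix_eq_sum_single V]
  rw [map_sum, ip_eq_sum]
  refine Finset.sum_congr rfl fun i _ => ?_
  rw [map_sum]
  refine Finset.sum_congr rfl fun j _ => ?_
  rw [show Matrix.single i j (V i j) = V i j • Matrix.single i j (1 : ℝ) by simp, map_smul, hφ]
  simp [matGrad, mul_comm]

end gradient

section prec

variable {n r : ℕ} {X : Matrix (Fin n) (Fin r) ℝ} {η : ℝ}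

/-- The inner product that the preconditioner induces, whose square norm is `precSq`. -/
lemma ip_mul_preconditioner (D V : Matrix (Fin n) (Fin r) ℝ) :
    ip (D * (Xᵀ * X + η • (1 : Matrix (Fin r) (Fin r) ℝ))) V =
      ip (D * Xᵀ) (V * Xᵀ) + η * ip D V := by
  rw [Matrix.mul_add, ip_add_left, Matrix.mul_smul, ip_smul_left, Matrix.mul_one,
    ← Matrix.mul_assoc, ip_mul_right (D * Xᵀ) X]

lemma ip_mul_preconditioner_le (hη : 0 ≤ η) (D V : Matrix (Fin n) (Fin r) ℝ) :
    ip (D * Xᵀ) (V * Xᵀ) + η * ip D V ≤ √(precSq X η D) * √(precSq X η V) := by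
  rw [← Real.sqrt_mul (precSq_nonneg X hη D)]
  refine Real.le_sqrt_of_sq_le ?_
  have h1 := abs_ip_le (D * Xᵀ) (V * Xᵀ)
  have h2 := abs_ip_le D V
  have h3 : |ip (D * Xᵀ) (V * Xᵀ) + η * ip D V| ≤
      ‖D * Xᵀ‖ * ‖V * Xᵀ‖ + η * (‖D‖ * ‖V‖) := by
    refine (abs_add_le _ _).trans (add_le_add h1 ?_)
    rw [abs_mul, abs_of_nonneg hη]
    exact mul_le_mul_of_nonneg_left h2 hη
  rw [← sq_abs]
  refine (pow_le_pow_left₀ (abs_nonneg _) h3 2).trans ?_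
  unfold precSq
  have := mul_nonneg hη (sq_nonneg (‖D * Xᵀ‖ * ‖V‖ - ‖V * Xᵀ‖ * ‖D‖))
  nlinarith

lemma isUnit_preconditioner (hη : 0 < η) :
    IsUnit (Xᵀ * X + η • (1 : Matrix (Fin r) (Fin r) ℝ)).det := by
  have hW : (Xᵀ * X).PosSemidef := by
    have := Matrix.posSemidef_conjTranspose_mul_self X
    rwa [Matrix.conjTranspose_eq_transpose_of_trivial] at this
  have : (Xᵀ * X + η • (1 : Matrix (Fin r) (Fin r) ℝ)).PosDef :=
    Matrix.PosDef.posSemidef_add hW (Matrix.PosDef.one.smul hη)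
  exact (Matrix.isUnit_iff_isUnit_det _).1 this.isUnit

lemma norm_sym_prod_le (hη : 0 ≤ η) (V : Matrix (Fin n) (Fin r) ℝ) :
    ‖V * Xᵀ + X * Vᵀ‖ ≤ 2 * √(precSq X η V) := by
  have h1 : ‖V * Xᵀ + X * Vᵀ‖ ≤ 2 * ‖V * Xᵀ‖ := by
    refine (norm_add_le _ _).trans (le_of_eq ?_)
    rw [← norm_transpose_frob (X * Vᵀ), Matrix.transpose_mul, Matrix.transpose_transpose]
    ring
  have h2 : ‖V * Xᵀ‖ ≤ √(precSq X η V) := by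
    apply Real.le_sqrt_of_sq_le
    unfold precSq
    have : 0 ≤ η * ‖V‖ ^ 2 := by positivity
    linarith
  linarith

lemma mul_norm_outer_le (hη : 0 ≤ η) (V : Matrix (Fin n) (Fin r) ℝ) :
    η * ‖V * Vᵀ‖ ≤ precSq X η V := by
  have h1 := norm_mul_le_frob V Vᵀ
  rw [norm_transpose_frob, ← sq] at h1
  unfold precSq
  nlinarith [sq_nonneg ‖V * Xᵀ‖]

lemma transpose_sym_prod (V : Matrix (Fin n) (Fin r) ℝ) :
    (V * Xᵀ + X * Vᵀ)ᵀ = V * Xᵀ + X * Vᵀ := by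
  rw [Matrix.transpose_add, Matrix.transpose_mul, Matrix.transpose_mul,
    Matrix.transpose_transpose, Matrix.transpose_transpose, add_comm]

end prec

/-! ### One step of preconditioned gradient descent -/

/-- A bound for the curvature of the loss along a preconditioned gradient step, when the damping
parameter is at least `h` times the error. -/
def stepConst (h : ℝ) : ℝ := 8 + 76 / h + 162 / h ^ 2

/-- The scalar estimate of one step: `p` is the length of the step direction, `e` the error, `s`
the noise level, `z` the norm of the second-order term `D Dᵀ`. -/
lemma descent_arith {g g' ψ qyy qez qyz qzz e p s α h μ z : ℝ}
    (he : 0 < e) (hp : 0 ≤ p) (hh : 0 < h) (hμ : 0 < μ) (hα : 0 < α)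
    (hαL : α ≤ 1 / (8 * stepConst h)) (hs : 4 * s ≤ 1 / 20 * √μ * e)
    (hz : h * e * z ≤ p ^ 2) (hz0 : 0 ≤ z)
    (hlow : √(2 * μ) * e - 4 * s ≤ p) (hup : p ≤ 9 * e) (hψ : p ^ 2 - 4 * s * p ≤ ψ)
    (hyy : qyy ≤ 8 * p ^ 2) (hez : qez ≤ 2 * e * z) (hyz : |qyz| ≤ 4 * p * z)
    (hzz : qzz ≤ 2 * z ^ 2) (hg : g ≤ 2 * e ^ 2)
    (hg' : g' = g - α * ψ + α ^ 2 * (qyy + 2 * qez) - 2 * α ^ 3 * qyz + α ^ 4 * qzz) :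
    g' ≤ (1 - α * μ / 2) * g := by
  have hS : 8 ≤ stepConst h := by
    unfold stepConst
    have : 0 ≤ 76 / h + 162 / h ^ 2 := by positivity
    linarith
  have hα1 : α ≤ 1 := by
    refine hαL.trans ?_
    rw [div_le_one (by positivity)]
    linarith
  have hαQ : α * stepConst h ≤ 1 / 8 := by
    rw [le_div_iff₀ (by positivity)] at hαL
    linarith
  have hzp : z ≤ p ^ 2 / (h * e) := by
    rw [le_div_iff₀ (by positivity)]; linarith
  have k1 : 2 * qez ≤ 4 / h * p ^ 2 := by
    have : 2 * (2 * e * z) ≤ 2 * (2 * e * (p ^ 2 / (h * e))) := by gcongr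
    have e1 : 2 * (2 * e * (p ^ 2 / (h * e))) = 4 / h * p ^ 2 := by field_simp; ring
    linarith
  have k2 : 2 * |qyz| ≤ 72 / h * p ^ 2 := by
    have : 2 * (4 * p * z) ≤ 2 * (4 * (9 * e) * (p ^ 2 / (h * e))) := by gcongr
    have e1 : 2 * (4 * (9 * e) * (p ^ 2 / (h * e))) = 72 / h * p ^ 2 := by field_simp; ring
    linarith
  have k3 : qzz ≤ 162 / h ^ 2 * p ^ 2 := by
    have : 2 * z ^ 2 ≤ 2 * (p ^ 2 / (h * e)) ^ 2 := by gcongr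
    have e1 : 2 * (p ^ 2 / (h * e)) ^ 2 = 2 / h ^ 2 * (p ^ 2 / e ^ 2) * p ^ 2 := by
      field_simp
    have e2 : p ^ 2 / e ^ 2 ≤ 81 := by
      rw [div_le_iff₀ (by positivity)]
      have := pow_le_pow_left₀ hp hup 2
      linarith only [this]
    have e3 : 2 / h ^ 2 * (p ^ 2 / e ^ 2) * p ^ 2 ≤ 2 / h ^ 2 * 81 * p ^ 2 := by gcongr
    have e4 : 2 / h ^ 2 * 81 * p ^ 2 = 162 / h ^ 2 * p ^ 2 := by ring
    linarith
  have k4 : α ^ 2 * (qyy + 2 * qez) - 2 * α ^ 3 * qyz + α ^ 4 * qzz ≤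
      α * (α * stepConst h) * p ^ 2 := by
    have a3 : α ^ 3 ≤ α ^ 2 := pow_le_pow_of_le_one hα.le hα1 (by norm_num)
    have a4 : α ^ 4 ≤ α ^ 2 := pow_le_pow_of_le_one hα.le hα1 (by norm_num)
    have b1 : α ^ 2 * (qyy + 2 * qez) ≤ α ^ 2 * (8 * p ^ 2 + 4 / h * p ^ 2) := by gcongr
    have b2 : -(2 * α ^ 3 * qyz) ≤ α ^ 2 * (72 / h * p ^ 2) := by
      have c1 : -(2 * α ^ 3 * qyz) ≤ α ^ 3 * (2 * |qyz|) := by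
        have := neg_abs_le qyz
        have : 0 ≤ α ^ 3 * (qyz + |qyz|) := mul_nonneg (by positivity) (by linarith)
        linarith
      have c2 : α ^ 3 * (2 * |qyz|) ≤ α ^ 2 * (72 / h * p ^ 2) := by gcongr
      linarith
    have b3 : α ^ 4 * qzz ≤ α ^ 2 * (162 / h ^ 2 * p ^ 2) := by
      have c1 : α ^ 4 * qzz ≤ α ^ 4 * (162 / h ^ 2 * p ^ 2) := by gcongr
      have c2 : α ^ 4 * (162 / h ^ 2 * p ^ 2) ≤ α ^ 2 * (162 / h ^ 2 * p ^ 2) := by gcongr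
      linarith
    have b4 : α * (α * stepConst h) * p ^ 2 =
        α ^ 2 * (8 * p ^ 2 + 4 / h * p ^ 2) + α ^ 2 * (72 / h * p ^ 2) +
          α ^ 2 * (162 / h ^ 2 * p ^ 2) := by
      unfold stepConst; ring
    linarith
  have k5 : α * (α * stepConst h) * p ^ 2 ≤ α * (1 / 8) * p ^ 2 := by gcongr
  have hsq : √(2 * μ) = √2 * √μ := Real.sqrt_mul (by norm_num) _
  have h2 : 1.4 < √2 := by
    rw [Real.lt_sqrt] <;> norm_num
  have hme : 0 < √μ * e := by positivity
  have k6 : 1.3 * (√μ * e) ≤ p := by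
    rw [hsq] at hlow
    have := mul_le_mul_of_nonneg_right h2.le hme.le
    linarith only [this, hlow, hs, hme]
  have k7 : 4 * s ≤ p / 8 := by linarith only [hs, k6, hme]
  have k8 : 4 * s * p ≤ p ^ 2 / 8 := by
    have := mul_le_mul_of_nonneg_right k7 hp
    linarith only [this]
  have k9 : 1.69 * (μ * e ^ 2) ≤ p ^ 2 := by
    have := pow_le_pow_left₀ (by positivity) k6 2
    rw [mul_pow, mul_pow, Real.sq_sqrt hμ.le] at this
    norm_num at this ⊢
    linarith only [this]
  have k10 : g' ≤ g - α * (3 / 4 * p ^ 2) := by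
    have : α * (p ^ 2 - 4 * s * p) ≤ α * ψ := by gcongr
    have h3 : α * (4 * s * p) ≤ α * (p ^ 2 / 8) := by gcongr
    linarith only [this, h3, k4, k5, hg']
  have k11 : μ * g ≤ μ * (2 * e ^ 2) := by gcongr
  have k12 : α * (μ * g / 2) ≤ α * (3 / 4 * p ^ 2) := by
    have := mul_pos hμ (pow_pos he 2)
    exact mul_le_mul_of_nonneg_left (by linarith only [k11, k9, this]) hα.le
  linarith only [k10, k12]

/-- One step decreases the noiseless loss by the factor `1 - α μ_P / 2` as long as the error
dominates the noise level `s`. -/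
lemma one_step {n m r rs : ℕ} {A : Fin m → Matrix (Fin n) (Fin n) ℝ}
    {M : Matrix (Fin n) (Fin n) ℝ} {X : Matrix (Fin n) (Fin r) ℝ} {δ ρ η s h α : ℝ}
    {y e : EuclideanSpace ℝ (Fin m)}
    (hM : M.PosSemidef) (hrank : M.rank = rs) (hrs : rs ≤ r) (hδ : 0 ≤ δ) (hδ1 : δ < 1)
    (hA : RIP A (2 * r) δ) (hρ0 : 0 < ρ) (hρ1 : ρ < 1)
    (hρ : ρ ^ 2 / (1 - ρ ^ 2) ≤ (1 - δ ^ 2) / 2) (hE0 : 0 < ‖X * Xᵀ - M‖)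
    (hEρ : ‖X * Xᵀ - M‖ ≤ ρ * lam hM.isHermitian rs)
    (hy : y = sense A M + e)
    (hnoise : ∀ Y : Matrix (Fin n) (Fin n) ℝ, Yᵀ = Y → Y.rank ≤ 2 * r →
      |1 / (m : ℝ) * inner ℝ e (sense A Y)| ≤ s * ‖Y‖)
    (hs0 : 0 ≤ s) (hs : 4 * s ≤ 1 / 20 * √(muP δ √(1 + δ) r rs) * ‖X * Xᵀ - M‖)
    (hh : 0 < h) (hηl : h * ‖X * Xᵀ - M‖ ≤ η) (hηE : η ≤ 3 / 2 * √(1 + δ) * ‖X * Xᵀ - M‖)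
    (hα : 0 < α) (hαL : α ≤ 1 / (8 * stepConst h)) {X' : Matrix (Fin n) (Fin r) ℝ}
    (hX' : X' = X - α • (matGrad (loss A y) X *
      (Xᵀ * X + η • (1 : Matrix (Fin r) (Fin r) ℝ))⁻¹)) :
    senseForm A (X' * X'ᵀ - M) (X' * X'ᵀ - M) ≤
      (1 - α * muP δ √(1 + δ) r rs / 2) * senseForm A (X * Xᵀ - M) (X * Xᵀ - M) := by
  have hη : 0 < η := lt_of_lt_of_le (by positivity) hηl
  have hEt : (X * Xᵀ - M)ᵀ = X * Xᵀ - M := by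
    rw [Matrix.transpose_sub, posSemidef_transpose_eq hM, Matrix.transpose_mul,
      Matrix.transpose_transpose]
  have hErk := rank_error_le X (hrank.le.trans hrs)
  obtain ⟨V, hV0, hV⟩ := exists_ascent_direction hM hrank hrs hδ hδ1 hA hρ0 hρ1 hρ hE0 hEρ hη.le hηE
  have hgrad : ∀ V, ip (matGrad (loss A y) X) V =
      2 * senseForm A (X * Xᵀ - M) (V * Xᵀ + X * Vᵀ) -
        2 * (1 / (m : ℝ) * inner ℝ e (sense A (V * Xᵀ + X * Vᵀ))) := by
    intro V
    rw [ip_matGrad_loss, hy, senseForm, sense_sub,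
      show sense A M + e - sense A (X * Xᵀ) = e - (sense A (X * Xᵀ) - sense A M) by abel,
      inner_sub_left e]
    ring
  obtain ⟨E, hE⟩ : ∃ E, E = X * Xᵀ - M := ⟨_, rfl⟩
  obtain ⟨G, hG⟩ : ∃ G, G = matGrad (loss A y) X := ⟨_, rfl⟩
  rw [← hE] at hgrad hEt hErk hV hE0 hEρ hs hηl hηE ⊢
  rw [← hG] at hX'
  simp only [← hG] at hgrad
  set W := Xᵀ * X + η • (1 : Matrix (Fin r) (Fin r) ℝ) with hW
  obtain ⟨D, hD⟩ : ∃ D, D = G * W⁻¹ := ⟨_, rfl⟩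
  have hDW : D * W = G := by
    rw [hD, Matrix.mul_assoc, Matrix.nonsing_inv_mul _ (isUnit_preconditioner hη), Matrix.mul_one]
  have hφ : ∀ V, ip G V = ip (D * Xᵀ) (V * Xᵀ) + η * ip D V := by
    intro V
    rw [← hDW, hW, ip_mul_preconditioner]
  obtain ⟨p, hp⟩ : ∃ p, p = √(precSq X η D) := ⟨_, rfl⟩
  have hp0 : 0 ≤ p := by rw [hp]; positivity
  have hp2 : p ^ 2 = precSq X η D := by rw [hp, Real.sq_sqrt (precSq_nonneg X hη.le D)]
  have hnb : ∀ V, |1 / (m : ℝ) * inner ℝ e (sense A (V * Xᵀ + X * Vᵀ))| ≤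
      s * (2 * √(precSq X η V)) := fun V =>
    (hnoise _ (transpose_sym_prod V) (rank_sym_prod_le X V)).trans
      (mul_le_mul_of_nonneg_left (norm_sym_prod_le hη.le V) hs0)
  have hDD : ip G D = p ^ 2 := by rw [hφ, ip_self, ip_self, hp2, precSq]
  obtain ⟨Y, hY⟩ : ∃ Y, Y = D * Xᵀ + X * Dᵀ := ⟨_, rfl⟩
  have hYt : Yᵀ = Y := by rw [hY, transpose_sym_prod]
  have hYrk : Y.rank ≤ 2 * r := by rw [hY]; exact rank_sym_prod_le X D
  have hYn : ‖Y‖ ≤ 2 * p := by rw [hY, hp]; exact norm_sym_prod_le hη.le D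
  obtain ⟨Z, hZ⟩ : ∃ Z, Z = D * Dᵀ := ⟨_, rfl⟩
  have hZt : Zᵀ = Z := by rw [hZ, Matrix.transpose_mul, Matrix.transpose_transpose]
  have hZrk : Z.rank ≤ 2 * r := by
    have := (Matrix.rank_mul_le_left D Dᵀ).trans (Matrix.rank_le_width D)
    rw [hZ]; omega
  have hZn : η * ‖Z‖ ≤ p ^ 2 := by rw [hp2, hZ]; exact mul_norm_outer_le hη.le D
  have hnD := abs_le.1 (hnb D)
  have hgD := hgrad D
  rw [hDD, ← hY] at hgD
  rw [← hY, ← hp] at hnD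
  have hlow : √(2 * muP δ √(1 + δ) r rs) * ‖E‖ - 4 * s ≤ p := by
    have h1 := hgrad V
    have h2 := abs_le.1 (hnb V)
    have h3 := ip_mul_preconditioner_le (X := X) hη.le D V
    rw [← hφ, ← hp] at h3
    have h4 : 0 < √(precSq X η V) := Real.sqrt_pos.2 hV0
    refine le_of_mul_le_mul_right ?_ h4
    linarith
  have hμ1 := muP_le_one hδ hδ1 (Real.sqrt_nonneg (1 + δ)) r rs
  have hμ0 := muP_pos hδ hδ1 (Real.sqrt_nonneg (1 + δ)) r rs
  have hδ2 : 1 + δ ≤ 2 := by linarith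
  have hEY := abs_le.1 (hA.abs_senseForm_le hδ hEt hErk hYt hYrk)
  have hup : p ≤ 9 * ‖E‖ := by
    have h1 : (1 + δ) * ‖E‖ * ‖Y‖ ≤ 2 * ‖E‖ * (2 * p) := by gcongr
    have h2 : p * p ≤ (8 * ‖E‖ + 4 * s) * p := by nlinarith
    have h3 : √(muP δ √(1 + δ) r rs) ≤ 1 := Real.sqrt_le_one.2 hμ1
    have h4 : 4 * s ≤ ‖E‖ := by nlinarith
    rcases hp0.eq_or_lt with h0 | h0
    · rw [← h0]; positivity
    · have := le_of_mul_le_mul_right h2 h0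
      linarith
  have hX'E : X' * X'ᵀ - M = E + (-α) • Y + α ^ 2 • Z := by
    rw [hX', ← hD, sub_eq_add_neg X, ← neg_smul, outer_add, ← hY, ← hZ, hE]
    simp only [neg_sq]
    abel
  have hn : ∀ B : Matrix (Fin n) (Fin n) ℝ, 0 ≤ ‖B‖ := fun B => norm_nonneg B
  refine descent_arith (ψ := 2 * senseForm A E Y) (qyy := senseForm A Y Y)
    (qez := senseForm A E Z) (qyz := senseForm A Y Z) (qzz := senseForm A Z Z)
    (z := ‖Z‖) hE0 hp0 hh hμ0 hα hαL hs ?_ (hn Z) hlow hup ?_ ?_ ?_ ?_ ?_ ?_ ?_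
  · exact (mul_le_mul_of_nonneg_right hηl (hn Z)).trans hZn
  · linarith
  · have h1 := (hA.senseForm_self_bounds hYt hYrk).2
    have h2 : (1 + δ) * ‖Y‖ ^ 2 ≤ 2 * (2 * p) ^ 2 := by gcongr
    linarith
  · have h1 := (abs_le.1 (hA.abs_senseForm_le hδ hEt hErk hZt hZrk)).2
    have h2 : (1 + δ) * ‖E‖ * ‖Z‖ ≤ 2 * ‖E‖ * ‖Z‖ := by gcongr
    linarith
  · have h1 := hA.abs_senseForm_le hδ hYt hYrk hZt hZrk
    have h2 : (1 + δ) * ‖Y‖ * ‖Z‖ ≤ 2 * (2 * p) * ‖Z‖ := by gcongr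
    linarith
  · have h1 := (hA.senseForm_self_bounds hZt hZrk).2
    have h2 : (1 + δ) * ‖Z‖ ^ 2 ≤ 2 * ‖Z‖ ^ 2 := by gcongr
    linarith
  · have h1 := (hA.senseForm_self_bounds hEt hErk).2
    have h2 : (1 + δ) * ‖E‖ ^ 2 ≤ 2 * ‖E‖ ^ 2 := by gcongr
    linarith
  · rw [hX'E]
    simp only [senseForm_add_left, senseForm_add_right, senseForm_smul_left,
      senseForm_smul_right, senseForm_comm A Y E, senseForm_comm A Z E, senseForm_comm A Z Y]
    ring

/-! ### Convergence up to the noise level -/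

/-- The squared damping parameter is the noiseless loss, up to the noise. -/
lemma abs_damping_sq_sub_le {n m r : ℕ} {A : Fin m → Matrix (Fin n) (Fin n) ℝ}
    {M : Matrix (Fin n) (Fin n) ℝ} (X : Matrix (Fin n) (Fin r) ℝ) {s d σ σhat : ℝ}
    {y e : EuclideanSpace ℝ (Fin m)} (hM : Mᵀ = M) (hr : M.rank ≤ r)
    (hy : y = sense A M + e)
    (hnoise : ∀ Y : Matrix (Fin n) (Fin n) ℝ, Yᵀ = Y → Y.rank ≤ 2 * r →
      |1 / (m : ℝ) * inner ℝ e (sense A Y)| ≤ s * ‖Y‖)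
    (hd : |1 / (m : ℝ) * ‖e‖ ^ 2 - σ ^ 2| ≤ d) :
    |damping A y σhat X ^ 2 - senseForm A (X * Xᵀ - M) (X * Xᵀ - M)| ≤
      2 * s * ‖X * Xᵀ - M‖ + d + |σ ^ 2 - σhat ^ 2| := by
  have hEt : (X * Xᵀ - M)ᵀ = X * Xᵀ - M := by
    rw [Matrix.transpose_sub, hM, Matrix.transpose_mul, Matrix.transpose_transpose]
  have h1 := hnoise _ hEt (rank_error_le X hr)
  have hloss : loss A y X = senseForm A (X * Xᵀ - M) (X * Xᵀ - M) -
      2 * (1 / (m : ℝ) * inner ℝ e (sense A (X * Xᵀ - M))) + 1 / (m : ℝ) * ‖e‖ ^ 2 := by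
    rw [loss, hy, senseForm_self, show sense A M + e - sense A (X * Xᵀ) =
      e - sense A (X * Xᵀ - M) by rw [sense_sub]; abel, norm_sub_sq_real]
    ring
  have hg : 0 ≤ senseForm A (X * Xᵀ - M) (X * Xᵀ - M) := by
    rw [senseForm_self]; positivity
  rw [damping, Real.sq_sqrt (abs_nonneg _), hloss]
  obtain ⟨g, hg'⟩ : ∃ g, g = senseForm A (X * Xᵀ - M) (X * Xᵀ - M) := ⟨_, rfl⟩
  obtain ⟨w, hw⟩ : ∃ w, w = 1 / (m : ℝ) * inner ℝ e (sense A (X * Xᵀ - M)) := ⟨_, rfl⟩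
  obtain ⟨u, hu⟩ : ∃ u, u = 1 / (m : ℝ) * ‖e‖ ^ 2 := ⟨_, rfl⟩
  rw [← hg'] at hg ⊢
  rw [← hw] at h1 ⊢
  rw [← hu] at hd ⊢
  have h2 := abs_abs_sub_abs_le_abs_sub (g - 2 * w + u - σhat ^ 2) g
  rw [abs_of_nonneg hg] at h2
  refine h2.trans ?_
  have h3 := abs_le.1 h1
  have h4 := abs_le.1 hd
  have h5 := abs_le.1 (le_refl |σ ^ 2 - σhat ^ 2|)
  rw [abs_le]
  constructor <;> linarith [h3.1, h3.2, h4.1, h4.2, h5.1, h5.2]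

/-- If the noise is within the level `B`, then the iterate of smallest damping parameter has
error at most a constant times the larger of `B` and the linearly convergent term. -/
lemma convergence_of_noise_le {δ₀ K₁ : ℝ} (hδ₀ : δ₀ < 1) (hK₁ : 1 ≤ K₁)
    {n m r rs : ℕ} {A : Fin m → Matrix (Fin n) (Fin n) ℝ}
    {M : Matrix (Fin n) (Fin n) ℝ} {δ ρ s d B σ σhat α : ℝ}
    {X₀ : Matrix (Fin n) (Fin r) ℝ} {y e : EuclideanSpace ℝ (Fin m)}
    (hM : M.PosSemidef) (hrank : M.rank = rs) (hrs : rs ≤ r) (hδ : 0 ≤ δ) (hδδ : δ ≤ δ₀)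
    (hA : RIP A (2 * r) δ) (hρ0 : 0 < ρ) (hρ1 : ρ < 1)
    (hρ : ρ ^ 2 / (1 - ρ ^ 2) ≤ (1 - δ ^ 2) / 2) (hy : y = sense A M + e)
    (hnoise : ∀ Y : Matrix (Fin n) (Fin n) ℝ, Yᵀ = Y → Y.rank ≤ 2 * r →
      |1 / (m : ℝ) * inner ℝ e (sense A Y)| ≤ s * ‖Y‖)
    (hd : |1 / (m : ℝ) * ‖e‖ ^ 2 - σ ^ 2| ≤ d)
    (hs0 : 0 ≤ s) (hB : 0 ≤ B) (hsB : s ^ 2 ≤ K₁ * muP δ √(1 + δ) r rs * B) (hdB : d ≤ K₁ * B)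
    (hσB : |σ ^ 2 - σhat ^ 2| ≤ B)
    (hinit : 1 / (m : ℝ) * ‖sense A (X₀ * X₀ᵀ - M)‖ ^ 2
      < ρ ^ 2 * (1 - δ) * lam hM.isHermitian rs ^ 2)
    (hα : 0 < α) (hαL : α ≤ 1 / (8 * stepConst √((1 - δ₀) / 2))) {K kstar : ℕ}
    (hmin : ∀ k ≤ K, damping A y σhat (iter A y σhat α X₀ kstar) ≤
      damping A y σhat (iter A y σhat α X₀ k)) :
    ‖iter A y σhat α X₀ kstar * (iter A y σhat α X₀ kstar)ᵀ - M‖ ^ 2 ≤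
      2 / (1 - δ₀) * (3 * (6400 * K₁ / (1 - δ₀) ^ 2) + 5 * K₁ + 2 * K₁ / (1 - δ₀)) *
        max ((1 + δ) / (1 - δ) * (1 - α * muP δ √(1 + δ) r rs / 2) ^ K * ‖X₀ * X₀ᵀ - M‖ ^ 2) B := by
  set X := iter A y σhat α X₀ with hX
  set μ := muP δ √(1 + δ) r rs with hμ
  have hδ1 : δ < 1 := by linarith
  have hμ0 : 0 < μ := muP_pos hδ hδ1 (Real.sqrt_nonneg (1 + δ)) r rs
  have hμ1 : μ ≤ 1 := muP_le_one hδ hδ1 (Real.sqrt_nonneg (1 + δ)) r rs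
  obtain ⟨ν, hν⟩ : ∃ ν, ν = 1 - δ₀ := ⟨_, rfl⟩
  rw [← hν] at hαL ⊢
  have hν0 : 0 < ν := by linarith
  have hν1 : ν ≤ 1 := by linarith
  have hνδ : ν ≤ 1 - δ := by linarith
  have hMt := posSemidef_transpose_eq hM
  have hMr : M.rank ≤ r := hrank.le.trans hrs
  set C₂ := 6400 * K₁ / ν ^ 2 with hC₂
  have hC₂1 : 1 ≤ C₂ := by
    rw [hC₂, le_div_iff₀ (by positivity)]
    have : ν ^ 2 ≤ 1 := pow_le_one₀ hν0.le hν1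
    linarith
  obtain ⟨g, hg⟩ : ∃ g : ℕ → ℝ, ∀ k, g k = senseForm A (X k * (X k)ᵀ - M) (X k * (X k)ᵀ - M) :=
    ⟨_, fun k => rfl⟩
  obtain ⟨x, hx⟩ : ∃ x : ℕ → ℝ, ∀ k, x k = ‖X k * (X k)ᵀ - M‖ := ⟨_, fun k => rfl⟩
  obtain ⟨η, hη⟩ : ∃ η : ℕ → ℝ, ∀ k, η k = damping A y σhat (X k) := ⟨_, fun k => rfl⟩
  have hx0 : ∀ k, 0 ≤ x k := fun k => by rw [hx]; exact norm_nonneg _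
  have hη0 : ∀ k, 0 ≤ η k := fun k => by rw [hη]; exact Real.sqrt_nonneg _
  have hgx : ∀ k, (1 - δ) * x k ^ 2 ≤ g k ∧ g k ≤ (1 + δ) * x k ^ 2 := by
    intro k
    rw [hg, hx]
    refine hA.senseForm_self_bounds ?_ (rank_error_le _ hMr)
    rw [Matrix.transpose_sub, hMt, Matrix.transpose_mul, Matrix.transpose_transpose]
  have hηg : ∀ k, |η k ^ 2 - g k| ≤ 2 * s * x k + d + |σ ^ 2 - σhat ^ 2| := by
    intro k
    rw [hη, hg, hx]
    exact abs_damping_sq_sub_le (X k) hMt hMr hy hnoise hd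
  have hKB : 0 ≤ K₁ * B := by positivity
  have hsK : s ^ 2 ≤ K₁ * B := by
    refine hsB.trans ?_
    have : K₁ * μ * B = μ * (K₁ * B) := by ring
    rw [this]
    exact mul_le_of_le_one_left hKB hμ1
  have hBK : B ≤ K₁ * B := le_mul_of_one_le_left hB hK₁
  have hνx : ∀ k, ν * x k ^ 2 ≤ g k := fun k =>
    (mul_le_mul_of_nonneg_right hνδ (sq_nonneg _)).trans (hgx k).1
  have hxg2 : ∀ k, g k ≤ 2 * x k ^ 2 := fun k =>
    (hgx k).2.trans (mul_le_mul_of_nonneg_right (by linarith) (sq_nonneg _))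
  obtain ⟨T, hT⟩ : ∃ T, T = (1 + δ) / (1 - δ) * (1 - α * μ / 2) ^ K * ‖X₀ * X₀ᵀ - M‖ ^ 2 :=
    ⟨_, rfl⟩
  rw [← hT]
  have hαμ : 0 ≤ 1 - α * μ / 2 := by
    have h1 : α ≤ 1 := by
      refine hαL.trans ?_
      have : 8 ≤ stepConst √(ν / 2) := by
        unfold stepConst
        have : 0 ≤ 76 / √(ν / 2) + 162 / √(ν / 2) ^ 2 := by positivity
        linarith
      rw [div_le_one (by linarith)]
      linarith
    have : α * μ ≤ 1 := mul_le_one₀ h1 hμ0.le hμ1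
    linarith
  have hαμ1 : 1 - α * μ / 2 ≤ 1 := by
    have : 0 < α * μ := by positivity
    linarith
  have hgnn : ∀ k, 0 ≤ g k := fun k => le_trans (by have := hx0 k; positivity) (hνx k)
  -- some iterate up to time `K` is as accurate as claimed
  have key : ∃ k ≤ K, x k ^ 2 ≤ C₂ * max T B := by
    by_cases hlarge : ∀ k ≤ K, C₂ * B < x k ^ 2
    · have hstep : ∀ k ≤ K, g k ≤ (1 - α * μ / 2) ^ k * g 0 := by
        intro k
        induction k with
        | zero => intro _; simp
        | succ k ih =>
          intro hk
          have hgk := ih (by omega)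
          have hxk := hlarge k (by omega)
          have hxp : 0 < x k := by
            have : 0 < x k ^ 2 := lt_of_le_of_lt (by positivity) hxk
            exact lt_of_le_of_ne (hx0 k) (fun h => by rw [← h] at this; simp at this)
          have hKBx : 6400 * (K₁ * B) ≤ ν ^ 2 * x k ^ 2 := by
            have h1 : C₂ * B * ν ^ 2 = 6400 * (K₁ * B) := by
              rw [hC₂]; field_simp
            rw [← h1, mul_comm (ν ^ 2)]
            exact mul_le_mul_of_nonneg_right hxk.le (sq_nonneg _)
          have hsx : 80 * s ≤ ν * x k := by
            apply (sq_le_sq₀ (by positivity) (by positivity)).1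
            rw [mul_pow, mul_pow]
            linarith
          have hsx2 : 80 * s * x k ≤ ν * x k ^ 2 := by
            have := mul_le_mul_of_nonneg_right hsx hxp.le
            linarith
          have hνx2 : ν ^ 2 * x k ^ 2 ≤ ν * x k ^ 2 := by
            refine mul_le_mul_of_nonneg_right ?_ (sq_nonneg _)
            rw [sq]
            exact mul_le_of_le_one_left hν0.le hν1
          have hdev := abs_le.1 (hηg k)
          have hνk := hνx k
          have hlo : ν / 2 * x k ^ 2 ≤ η k ^ 2 := by linarith [hdev.1]
          have hhi : η k ^ 2 ≤ 3 / 2 * g k := by linarith [hdev.2]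
          have h1 : √(ν / 2) * x k ≤ η k := by
            apply (sq_le_sq₀ (by positivity) (hη0 k)).1
            rwa [mul_pow, Real.sq_sqrt (by positivity)]
          have h2 : η k ≤ 3 / 2 * √(1 + δ) * x k := by
            apply (sq_le_sq₀ (hη0 k) (by positivity)).1
            rw [mul_pow, mul_pow, Real.sq_sqrt (by positivity)]
            have := (hgx k).2
            have h3 : 0 ≤ (1 + δ) * x k ^ 2 := by positivity
            linarith
          have h3 : 4 * s ≤ 1 / 20 * √μ * x k := by
            apply (sq_le_sq₀ (by positivity) (by positivity)).1
            rw [mul_pow, mul_pow, mul_pow, Real.sq_sqrt hμ0.le]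
            have e1 : μ * (6400 * (K₁ * B)) ≤ μ * (x k ^ 2) := by
              refine mul_le_mul_of_nonneg_left (hKBx.trans ?_) hμ0.le
              exact mul_le_of_le_one_left (sq_nonneg _) (pow_le_one₀ hν0.le hν1)
            linarith
          have h4 : x k ≤ ρ * lam hM.isHermitian rs := by
            apply (sq_le_sq₀ (hx0 k) (mul_nonneg hρ0.le (lam_nonneg hM))).1
            have e1 : g k ≤ g 0 := hgk.trans (mul_le_of_le_one_left (hgnn 0)
              (pow_le_one₀ hαμ hαμ1))
            have e2 : g 0 < ρ ^ 2 * (1 - δ) * lam hM.isHermitian rs ^ 2 := by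
              rw [hg, senseForm_self]
              exact hinit
            have e3 := (hgx k).1
            have e4 : 0 < 1 - δ := by linarith
            refine le_of_mul_le_mul_left ?_ e4
            linarith
          have h5 := one_step (X := X k) (X' := X (k + 1)) hM hrank hrs hδ hδ1 hA hρ0 hρ1 hρ
            (by rw [← hx]; exact hxp) (by rw [← hx]; exact h4) hy hnoise hs0
            (by rw [← hx]; exact h3) (Real.sqrt_pos.2 (by positivity : 0 < ν / 2))
            (by rw [← hx, ← hη]; exact h1) (by rw [← hx, ← hη]; exact h2) hα hαL rfl
          rw [← hg, ← hg, ← hμ] at h5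
          refine h5.trans ?_
          rw [pow_succ']
          rw [mul_assoc]
          exact mul_le_mul_of_nonneg_left hgk hαμ
      refine ⟨K, le_rfl, ?_⟩
      have h1 : x K ^ 2 ≤ T := by
        have h2 := (hgx K).1
        have h3 := hstep K le_rfl
        have h4 := mul_le_mul_of_nonneg_left (hgx 0).2 (pow_nonneg hαμ K)
        have h5 : x 0 = ‖X₀ * X₀ᵀ - M‖ := hx 0
        rw [hT, ← h5, div_mul_eq_mul_div, div_mul_eq_mul_div, le_div_iff₀ (by linarith)]
        linarith
      refine h1.trans ((le_max_left T B).trans ?_)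
      exact le_mul_of_one_le_left (hB.trans (le_max_right _ _)) hC₂1
    · push Not at hlarge
      obtain ⟨k, hk, hkx⟩ := hlarge
      exact ⟨k, hk, hkx.trans (mul_le_mul_of_nonneg_left (le_max_right _ _) (by positivity))⟩
  obtain ⟨k, hk, hkx⟩ := key
  obtain ⟨R, hR⟩ : ∃ R, R = max T B := ⟨_, rfl⟩
  rw [← hR] at hkx ⊢
  have hBR : B ≤ R := by rw [hR]; exact le_max_right _ _
  have hKR : K₁ * B ≤ K₁ * R := mul_le_mul_of_nonneg_left hBR (by linarith)
  have h1 : η k ^ 2 ≤ 3 * C₂ * R + 3 * (K₁ * R) := by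
    have e1 := (abs_le.1 (hηg k)).2
    have e2 := hxg2 k
    have e3 := sq_nonneg (s - x k)
    linarith
  have h2 : η kstar ^ 2 ≤ η k ^ 2 := by
    have := hmin k hk
    rw [← hη, ← hη] at this
    exact pow_le_pow_left₀ (hη0 _) this 2
  have h3 := (abs_le.1 (hηg kstar)).1
  have h4 := hνx kstar
  have h5 : 2 * s * x kstar ≤ ν / 2 * x kstar ^ 2 + 2 / ν * s ^ 2 := by
    have e1 := mul_nonneg (by positivity : 0 ≤ 1 / (2 * ν)) (sq_nonneg (ν * x kstar - 2 * s))
    have e2 : 1 / (2 * ν) * (ν * x kstar - 2 * s) ^ 2 =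
        ν / 2 * x kstar ^ 2 + 2 / ν * s ^ 2 - 2 * s * x kstar := by
      field_simp
      ring
    linarith
  have h6 : 2 / ν * s ^ 2 ≤ 2 / ν * (K₁ * R) :=
    mul_le_mul_of_nonneg_left (hsK.trans hKR) (by positivity)
  have h7 : ν / 2 * x kstar ^ 2 ≤ (3 * C₂ + 5 * K₁ + 2 * K₁ / ν) * R := by
    have : 2 * K₁ / ν * R = 2 / ν * (K₁ * R) := by ring
    linarith
  rw [← hx]
  have h8 := mul_le_mul_of_nonneg_left h7 (by positivity : 0 ≤ 2 / ν)
  have h9 : 2 / ν * (ν / 2 * x kstar ^ 2) = x kstar ^ 2 := by field_simp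
  rw [h9] at h8
  linarith

/-! ### Quadratic forms on a grid -/

/-- A grid of mesh `1 / (4 n)` in the cube `[-1, 1]ⁿ`. -/
def gridPoint {n : ℕ} (z : Fin n → Fin (8 * n + 1)) : Fin n → ℝ :=
  fun i => ((z i : ℝ) - 4 * n) / (4 * n)

/-- Rounding towards zero. -/
lemma exists_round {N : ℕ} (hN : 0 < N) {x : ℝ} (hx : |x| ≤ 1) :
    ∃ j : Fin (2 * N + 1), |((j : ℝ) - N) / N| ≤ |x| ∧ |x - ((j : ℝ) - N) / N| ≤ 1 / N := by
  have hN' : (0 : ℝ) < N := by exact_mod_cast hN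
  set k := ⌊|x| * N⌋₊ with hk
  have h1 : (k : ℝ) ≤ |x| * N := Nat.floor_le (by positivity)
  have h2 : |x| * N < k + 1 := Nat.lt_floor_add_one _
  have hkN : k ≤ N := by
    have : (k : ℝ) ≤ N := h1.trans (mul_le_of_le_one_left hN'.le hx)
    exact_mod_cast this
  have h3 : (k : ℝ) / N ≤ |x| := by rwa [div_le_iff₀ hN']
  have h4 : |x| - k / N ≤ 1 / N := by
    rw [sub_le_iff_le_add, ← add_div, le_div_iff₀ hN']
    linarith
  rcases le_total 0 x with h0 | h0
  · refine ⟨⟨N + k, by omega⟩, ?_⟩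
    have e : (((N + k : ℕ) : ℝ) - N) / N = k / N := by push_cast; ring
    simp only [e]
    rw [abs_of_nonneg h0] at *
    rw [abs_of_nonneg (by positivity), abs_of_nonneg (by linarith)]
    exact ⟨h3, h4⟩
  · refine ⟨⟨N - k, by omega⟩, ?_⟩
    have e : (((N - k : ℕ) : ℝ) - N) / N = -(k / N) := by
      rw [Nat.cast_sub hkN]; ring
    simp only [e]
    rw [abs_of_nonpos h0] at *
    rw [abs_neg, abs_of_nonneg (by positivity), abs_of_nonpos (by linarith)]
    exact ⟨h3, by linarith⟩

lemma exists_gridPoint_near {n : ℕ} {x : Fin n → ℝ} (hx : x ⬝ᵥ x ≤ 1) :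
    ∃ z, gridPoint z ⬝ᵥ gridPoint z ≤ 1 ∧
      16 * ((x - gridPoint z) ⬝ᵥ (x - gridPoint z)) ≤ 1 := by
  rcases Nat.eq_zero_or_pos n with rfl | hn
  · exact ⟨fun i => i.elim0, by simp [dotProduct], by simp [dotProduct]⟩
  have hxi : ∀ i, |x i| ≤ 1 := by
    intro i
    have : x i * x i ≤ x ⬝ᵥ x :=
      Finset.single_le_sum (f := fun i => x i * x i) (fun i _ => mul_self_nonneg _)
        (Finset.mem_univ i)
    rw [← sq_le_one_iff_abs_le_one, sq]
    linarith
  choose j hj using fun i => exists_round (N := 4 * n) (by omega) (hxi i)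
  have hn' : (0 : ℝ) < n := by exact_mod_cast hn
  have hj' : ∀ i, gridPoint (fun i => Fin.cast (by omega) (j i)) i =
      ((j i : ℝ) - (4 * n : ℕ)) / (4 * n : ℕ) := by
    intro i; simp [gridPoint]
  refine ⟨fun i => Fin.cast (by omega) (j i), ?_, ?_⟩
  · refine le_trans (Finset.sum_le_sum fun i _ => ?_) hx
    rw [hj', ← abs_mul_abs_self, ← abs_mul_abs_self (x i)]
    exact mul_self_le_mul_self (abs_nonneg _) (hj i).1
  · have : (x - gridPoint fun i => Fin.cast (by omega) (j i)) ⬝ᵥ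
        (x - gridPoint fun i => Fin.cast (by omega) (j i)) ≤
        ∑ _i : Fin n, (1 / ((4 * n : ℕ) : ℝ)) * (1 / ((4 * n : ℕ) : ℝ)) := by
      refine Finset.sum_le_sum fun i _ => ?_
      rw [Pi.sub_apply, hj', ← abs_mul_abs_self]
      exact mul_self_le_mul_self (abs_nonneg _) (hj i).2
    rw [Finset.sum_const, Finset.card_univ, Fintype.card_fin, nsmul_eq_mul] at this
    push_cast at this
    have e : (n : ℝ) * (1 / (4 * n) * (1 / (4 * n))) = 1 / (16 * n) := by
      field_simp; ring
    rw [e] at this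
    have h1 : (1 : ℝ) ≤ n := by exact_mod_cast hn
    have h2 : 16 * (1 / (16 * (n : ℝ))) ≤ 1 := by
      rw [mul_one_div, div_le_one (by positivity)]
      linarith
    linarith

/-- A quadratic form is controlled on the whole unit ball by its values at the grid points in the
ball: at a maximizer, rounding to the grid changes the form by at most half of the maximum. -/
lemma abs_quadratic_le_of_grid {n : ℕ} (S : Matrix (Fin n) (Fin n) ℝ) {b : ℝ}
    (h : ∀ z, gridPoint z ⬝ᵥ gridPoint z ≤ 1 → |gridPoint z ⬝ᵥ S *ᵥ gridPoint z| ≤ b)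
    (x : Fin n → ℝ) : |x ⬝ᵥ S *ᵥ x| ≤ 2 * b * (x ⬝ᵥ x) := by
  set q : (Fin n → ℝ) → ℝ := fun x => x ⬝ᵥ S *ᵥ x with hq
  have hnorm : ∀ v : EuclideanSpace ℝ (Fin n), ‖v‖ ^ 2 = v.ofLp ⬝ᵥ v.ofLp := by
    intro v
    rw [EuclideanSpace.real_norm_sq_eq]
    simp [dotProduct, sq]
  have hcont : Continuous fun v : EuclideanSpace ℝ (Fin n) => |q v.ofLp| := by
    simp only [hq, dotProduct, Matrix.mulVec]
    fun_prop
  obtain ⟨v, hv, hmax⟩ := (isCompact_closedBall (0 : EuclideanSpace ℝ (Fin n)) 1).exists_isMaxOn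
    ⟨0, by simp⟩ hcont.continuousOn
  have hsmul : ∀ (c : ℝ) x, q (c • x) = c ^ 2 * q x := by
    intro c x
    simp only [hq, Matrix.mulVec_smul, smul_dotProduct, dotProduct_smul, smul_eq_mul]
    ring
  obtain ⟨B, hB⟩ : ∃ B, B = |q v.ofLp| := ⟨_, rfl⟩
  have hB0 : 0 ≤ B := by rw [hB]; positivity
  have hqB : ∀ x, |q x| ≤ B * (x ⬝ᵥ x) := by
    intro x
    rcases eq_or_ne x 0 with rfl | hx
    · simp [hq]
    have hxx : 0 < ‖(WithLp.toLp 2 x : EuclideanSpace ℝ (Fin n))‖ := by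
      rw [norm_pos_iff]
      intro h0
      apply hx
      simpa using congrArg WithLp.ofLp h0
    set w := ‖(WithLp.toLp 2 x : EuclideanSpace ℝ (Fin n))‖ with hw
    have hw2 : w ^ 2 = x ⬝ᵥ x := hnorm _
    have h1 := hmax (show (WithLp.toLp 2 (w⁻¹ • x) : EuclideanSpace ℝ (Fin n)) ∈
        Metric.closedBall 0 1 by
      rw [mem_closedBall_zero_iff, WithLp.toLp_smul, norm_smul, ← hw, norm_inv, norm_norm,
        inv_mul_cancel₀ hxx.ne'])
    simp only [Set.mem_ofPred_eq] at h1
    rw [hsmul, ← hB, abs_mul, abs_of_nonneg (by positivity), inv_pow,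
      inv_mul_le_iff₀ (by positivity), hw2] at h1
    linarith
  have hv1 : v.ofLp ⬝ᵥ v.ofLp ≤ 1 := by
    rw [← hnorm]
    exact pow_le_one₀ (norm_nonneg _) (mem_closedBall_zero_iff.1 hv)
  obtain ⟨z, hz1, hz2⟩ := exists_gridPoint_near hv1
  have hBb : B ≤ 2 * b := by
    set u := v.ofLp
    set w := gridPoint z
    -- the factor `8` balances the lengths of `u - w` and of `u + w`
    have e1 : q u - q w = 1 / 32 * (q ((8 : ℝ) • (u - w) + (u + w)) -
        q ((8 : ℝ) • (u - w) - (u + w))) := by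
      simp only [hq, Matrix.mulVec_add, Matrix.mulVec_sub, Matrix.mulVec_smul, add_dotProduct,
        sub_dotProduct, smul_dotProduct, dotProduct_add, dotProduct_sub, dotProduct_smul,
        smul_eq_mul]
      ring
    have e2 : ((8 : ℝ) • (u - w) + (u + w)) ⬝ᵥ ((8 : ℝ) • (u - w) + (u + w)) +
        ((8 : ℝ) • (u - w) - (u + w)) ⬝ᵥ ((8 : ℝ) • (u - w) - (u + w)) +
        2 * ((u - w) ⬝ᵥ (u - w)) =
        130 * ((u - w) ⬝ᵥ (u - w)) + 2 * ((u + w) ⬝ᵥ (u + w)) := by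
      simp only [add_dotProduct,
        sub_dotProduct, smul_dotProduct, dotProduct_add, dotProduct_sub, dotProduct_smul,
        smul_eq_mul]
      ring
    have e3 : (u + w) ⬝ᵥ (u + w) + (u - w) ⬝ᵥ (u - w) = 2 * (u ⬝ᵥ u) + 2 * (w ⬝ᵥ w) := by
      simp only [add_dotProduct, sub_dotProduct, dotProduct_add, dotProduct_sub]
      ring
    have e4 : 0 ≤ (u - w) ⬝ᵥ (u - w) := by
      simp only [dotProduct]
      exact Finset.sum_nonneg fun i _ => mul_self_nonneg _
    have e5 := abs_le.1 (hqB ((8 : ℝ) • (u - w) + (u + w)))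
    have e6 := abs_le.1 (hqB ((8 : ℝ) • (u - w) - (u + w)))
    have e7 : B * (((8 : ℝ) • (u - w) + (u + w)) ⬝ᵥ ((8 : ℝ) • (u - w) + (u + w)) +
        ((8 : ℝ) • (u - w) - (u + w)) ⬝ᵥ ((8 : ℝ) • (u - w) - (u + w))) ≤ B * 16 := by
      refine mul_le_mul_of_nonneg_left ?_ hB0
      linarith
    have e8 := abs_le.1 (h z hz1)
    rw [mul_add] at e7
    have e9 : |q u| ≤ b + B / 2 := by
      rw [abs_le]
      have e10 : q w = w ⬝ᵥ S *ᵥ w := rfl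
      constructor <;> linarith [e5.1, e5.2, e6.1, e6.2, e8.1, e8.2]
    rw [← hB] at e9
    linarith
  have hxx : 0 ≤ x ⬝ᵥ x := by
    simp only [dotProduct]
    exact Finset.sum_nonneg fun i _ => mul_self_nonneg _
  exact (hqB x).trans (mul_le_mul_of_nonneg_right hBb hxx)

/-- Duality between the spectral norm and low-rank symmetric matrices. -/
lemma abs_ip_le_of_quadratic_le {n k : ℕ} {S : Matrix (Fin n) (Fin n) ℝ} {b : ℝ}
    (hb : ∀ x : Fin n → ℝ, |x ⬝ᵥ S *ᵥ x| ≤ b * (x ⬝ᵥ x)) (hb0 : 0 ≤ b)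
    {Y : Matrix (Fin n) (Fin n) ℝ} (hY : Yᵀ = Y) (hr : Y.rank ≤ k) :
    |ip S Y| ≤ b * √k * ‖Y‖ := by
  have hH : Y.IsHermitian := by
    rw [Matrix.IsHermitian, Matrix.conjTranspose_eq_transpose_of_trivial, hY]
  set l := hH.eigenvalues with hl
  set U := (hH.eigenvectorUnitary : Matrix (Fin n) (Fin n) ℝ) with hU
  have hYl : Y = U * Matrix.diagonal l * Uᵀ := (fcalc_eigenvalues hH).symm
  have hcol : ∀ i, (Uᵀ i) ⬝ᵥ (Uᵀ i) = 1 := by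
    intro i
    have := congrFun (congrFun (eigU_transpose_mul hH) i) i
    rw [Matrix.one_apply_eq, Matrix.mul_apply] at this
    exact this
  have h1 : ip S Y = ∑ i, (Uᵀ i ⬝ᵥ S *ᵥ Uᵀ i) * l i := by
    conv_lhs => rw [hYl]
    rw [ip_comm, ip_mul_right, Matrix.transpose_transpose, ip_mul_left, ip_eq_sum]
    refine Finset.sum_congr rfl fun i _ => ?_
    rw [Finset.sum_eq_single i]
    · rw [Matrix.diagonal_apply_eq, mul_comm]
      congr 1
    · intro j _ hj
      rw [Matrix.diagonal_apply_ne _ (Ne.symm hj), zero_mul]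
    · simp
  have h2 : ‖Y‖ ^ 2 = ∑ i, l i * l i := by
    rw [← fcalc_trace hH, ← fcalc_mul, fcalc_eigenvalues, trace_sq_of_symm hY]
  have h3 : ∑ i, |l i| = ∑ i ∈ Finset.univ.filter fun i => l i ≠ 0, |l i| := by
    rw [Finset.sum_filter]
    refine Finset.sum_congr rfl fun i _ => ?_
    by_cases h : l i = 0 <;> simp [h]
  have hcard : (Finset.univ.filter fun i => l i ≠ 0).card ≤ k := by
    rwa [hH.rank_eq_card_non_zero_eigs, Fintype.card_subtype] at hr
  have h4 : ∑ i, |l i| ≤ √k * ‖Y‖ := by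
    apply (sq_le_sq₀ (Finset.sum_nonneg fun i _ => abs_nonneg _) (by positivity)).1
    rw [mul_pow, Real.sq_sqrt (by positivity), h2, h3]
    refine sq_sum_le_card_mul_sum_sq.trans ?_
    gcongr ?_ * ?_
    · exact_mod_cast hcard
    · simp only [sq_abs, ← sq]
      exact Finset.sum_le_univ_sum_of_nonneg fun i => sq_nonneg _
  calc |ip S Y| ≤ ∑ i, |Uᵀ i ⬝ᵥ S *ᵥ Uᵀ i * l i| := by
        rw [h1]; exact Finset.abs_sum_le_sum_abs _ _
    _ ≤ ∑ i, b * |l i| := by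
        refine Finset.sum_le_sum fun i _ => ?_
        rw [abs_mul]
        have := hb (Uᵀ i)
        rw [hcol, mul_one] at this
        exact mul_le_mul_of_nonneg_right this (abs_nonneg _)
    _ = b * ∑ i, |l i| := by rw [Finset.mul_sum]
    _ ≤ b * (√k * ‖Y‖) := mul_le_mul_of_nonneg_left h4 hb0
    _ = b * √k * ‖Y‖ := by ring

/-! ### Squares of sub-Gaussian random variables -/

section subgaussian

variable {Ω : Type*} [MeasurableSpace Ω] {P : Measure Ω} [IsProbabilityMeasure P]

lemma lintegral_exp_neg_mul_sq {b : ℝ} (hb : 0 < b) :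
    ∫⁻ g : ℝ, ENNReal.ofReal (Real.exp (-b * g ^ 2)) = ENNReal.ofReal √(Real.pi / b) := by
  rw [← integral_gaussian b, ofReal_integral_eq_lintegral_ofReal (integrable_exp_neg_mul_sq hb)
    (ae_of_all _ fun _ => (Real.exp_pos _).le)]

/-- The Gaussian linearization `√π exp(b² / 4) = ∫ exp(-g² + b g) dg`. -/
lemma lintegral_exp_neg_sq_add_mul (b : ℝ) :
    ∫⁻ g : ℝ, ENNReal.ofReal (Real.exp (-g ^ 2 + b * g)) =
      ENNReal.ofReal √Real.pi * ENNReal.ofReal (Real.exp (b ^ 2 / 4)) := by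
  have h1 : ∀ g : ℝ, ENNReal.ofReal (Real.exp (-g ^ 2 + b * g)) =
      ENNReal.ofReal (Real.exp (-1 * (g - b / 2) ^ 2)) *
        ENNReal.ofReal (Real.exp (b ^ 2 / 4)) := by
    intro g
    rw [← ENNReal.ofReal_mul (Real.exp_pos _).le, ← Real.exp_add]
    ring_nf
  simp_rw [h1]
  rw [lintegral_mul_const _ (by fun_prop),
    lintegral_sub_right_eq_self (fun g : ℝ => ENNReal.ofReal (Real.exp (-1 * g ^ 2))),
    lintegral_exp_neg_mul_sq one_pos, div_one]

/-- The square is linearized by an independent Gaussian variable, and the expectation over `X` is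
taken before the Gaussian one. -/
lemma lintegral_exp_sq_le {X : Ω → ℝ} (hX : Measurable X) {c : ℝ≥0} (hc : 0 < c)
    (h : HasSubgaussianMGF X c P) :
    ∫⁻ ω, ENNReal.ofReal (Real.exp (X ω ^ 2 / (4 * c))) ∂P ≤ 2 := by
  have hc' : (0 : ℝ) < c := hc
  have hπ : 0 < √Real.pi := Real.sqrt_pos.2 Real.pi_pos
  have h1 : ENNReal.ofReal √Real.pi * ∫⁻ ω, ENNReal.ofReal (Real.exp (X ω ^ 2 / (4 * c))) ∂P =
      ∫⁻ ω, (∫⁻ g : ℝ, ENNReal.ofReal (Real.exp (-g ^ 2 + X ω / √c * g))) ∂P := by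
    rw [← lintegral_const_mul _ (by fun_prop)]
    refine lintegral_congr fun ω => ?_
    rw [lintegral_exp_neg_sq_add_mul, div_pow, Real.sq_sqrt hc'.le, div_div, mul_comm (c : ℝ)]
  have h2 : ∫⁻ ω, (∫⁻ g : ℝ, ENNReal.ofReal (Real.exp (-g ^ 2 + X ω / √c * g))) ∂P ≤
      ENNReal.ofReal √Real.pi * ENNReal.ofReal √2 := by
    rw [lintegral_lintegral_swap (by fun_prop)]
    calc ∫⁻ g : ℝ, ∫⁻ ω, ENNReal.ofReal (Real.exp (-g ^ 2 + X ω / √c * g)) ∂P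
        ≤ ∫⁻ g : ℝ, ENNReal.ofReal (Real.exp (-(1 / 2) * g ^ 2)) := by
          refine lintegral_mono fun g => ?_
          have e1 : ∀ ω, ENNReal.ofReal (Real.exp (-g ^ 2 + X ω / √c * g)) =
              ENNReal.ofReal (Real.exp (-g ^ 2)) *
                ENNReal.ofReal (Real.exp (g / √c * X ω)) := by
            intro ω
            rw [← ENNReal.ofReal_mul (Real.exp_pos _).le, ← Real.exp_add]
            ring_nf
          simp_rw [e1]
          rw [lintegral_const_mul _ (by fun_prop),
            ← ofReal_integral_eq_lintegral_ofReal (h.integrable_exp_mul _)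
              (ae_of_all _ fun _ => (Real.exp_pos _).le),
            ← ENNReal.ofReal_mul (Real.exp_pos _).le]
          refine ENNReal.ofReal_le_ofReal ?_
          have e2 := h.mgf_le (g / √c)
          rw [div_pow, Real.sq_sqrt hc'.le] at e2
          refine (mul_le_mul_of_nonneg_left e2 (Real.exp_pos _).le).trans (le_of_eq ?_)
          rw [← Real.exp_add]
          congr 1
          field_simp
          ring
      _ = ENNReal.ofReal √Real.pi * ENNReal.ofReal √2 := by
          rw [lintegral_exp_neg_mul_sq (by norm_num), ← ENNReal.ofReal_mul hπ.le,
            ← Real.sqrt_mul Real.pi_pos.le]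
          congr 2
          ring
  rw [← h1] at h2
  have h3 := (ENNReal.mul_le_mul_iff_right (by simpa using hπ) ENNReal.ofReal_ne_top).1 h2
  refine h3.trans ?_
  rw [← ENNReal.ofReal_ofNat 2]
  refine ENNReal.ofReal_le_ofReal ?_
  rw [Real.sqrt_le_left] <;> norm_num

lemma integrable_exp_sq {X : Ω → ℝ} (hX : Measurable X) {c : ℝ≥0} (hc : 0 < c)
    (h : HasSubgaussianMGF X c P) :
    Integrable (fun ω => Real.exp (X ω ^ 2 / (4 * c))) P ∧
      ∫ ω, Real.exp (X ω ^ 2 / (4 * c)) ∂P ≤ 2 := by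
  have h1 := lintegral_exp_sq_le hX hc h
  have h2 : Integrable (fun ω => Real.exp (X ω ^ 2 / (4 * c))) P := by
    refine ⟨by fun_prop, ?_⟩
    rw [hasFiniteIntegral_iff_ofReal (ae_of_all _ fun _ => (Real.exp_pos _).le)]
    exact h1.trans_lt (by simp)
  refine ⟨h2, ?_⟩
  rw [← ofReal_integral_eq_lintegral_ofReal h2 (ae_of_all _ fun _ => (Real.exp_pos _).le),
    ← ENNReal.ofReal_ofNat 2] at h1
  exact (ENNReal.ofReal_le_ofReal_iff (by norm_num)).1 h1

lemma exp_le_one_add_add_sq_mul (y : ℝ) : Real.exp y ≤ 1 + y + y ^ 2 * Real.exp |y| := by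
  have h1 : Real.exp y - 1 - y ≤ y * (Real.exp y - 1) := by
    have e1 := Real.add_one_le_exp (-y)
    have e2 : Real.exp y * Real.exp (-y) = 1 := by rw [← Real.exp_add]; simp
    nlinarith [Real.exp_pos y]
  rcases le_total 0 y with h0 | h0
  · rw [abs_of_nonneg h0]
    have e1 := Real.add_one_le_exp (-y)
    have e2 : Real.exp y * Real.exp (-y) = 1 := by rw [← Real.exp_add]; simp
    have e3 : Real.exp y - 1 ≤ y * Real.exp y := by nlinarith [Real.exp_pos y]
    nlinarith
  · have e1 := Real.add_one_le_exp y
    have e2 : 1 ≤ Real.exp |y| := Real.one_le_exp (abs_nonneg y)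
    nlinarith [sq_nonneg y]

/-- The moment generating function of a centered square of a sub-Gaussian random variable, near
the origin. -/
lemma mgf_sq_sub_le {X : Ω → ℝ} (hX : Measurable X) {c : ℝ≥0} (hc : 0 < c)
    (h : HasSubgaussianMGF X c P) {s : ℝ} (hs : |s| ≤ 1 / (8 * c)) :
    Integrable (fun ω => Real.exp (s * (X ω ^ 2 - ∫ ω, X ω ^ 2 ∂P))) P ∧
      mgf (fun ω => X ω ^ 2 - ∫ ω, X ω ^ 2 ∂P) P s ≤ Real.exp (768 * (c : ℝ) ^ 2 * s ^ 2) := by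
  have hc' : (0 : ℝ) < c := hc
  obtain ⟨hI, hE⟩ := integrable_exp_sq hX hc h
  have hX2 : Integrable (fun ω => X ω ^ 2) P := (h.memLp 2).integrable_sq
  set w := ∫ ω, X ω ^ 2 ∂P with hw
  have hw0 : 0 ≤ w := integral_nonneg fun _ => sq_nonneg _
  have hw4 : w ≤ 4 * c := by
    have e1 : ∫ ω, (X ω ^ 2 / (4 * c) + 1) ∂P ≤ ∫ ω, Real.exp (X ω ^ 2 / (4 * c)) ∂P :=
      integral_mono ((hX2.div_const _).add (integrable_const _)) hI
        fun ω => Real.add_one_le_exp _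
    rw [integral_add (hX2.div_const _) (integrable_const _), integral_div, ← hw] at e1
    simp at e1
    have e2 : w / (4 * c) ≤ 1 := by linarith
    rwa [div_le_one (by positivity)] at e2
  have habs : ∀ ω, |X ω ^ 2 - w| ≤ X ω ^ 2 + w := by
    intro ω
    rw [abs_le]
    constructor <;> nlinarith [sq_nonneg (X ω)]
  have hew : Real.exp (w / (4 * c)) ≤ 3 := by
    have : w / (4 * c) ≤ 1 := by rwa [div_le_one (by positivity)]
    exact (Real.exp_le_exp.2 this).trans (by linarith [Real.exp_one_lt_d9])
  have hbd : ∀ ω, Real.exp (|X ω ^ 2 - w| / (4 * c)) ≤ 3 * Real.exp (X ω ^ 2 / (4 * c)) := by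
    intro ω
    calc Real.exp (|X ω ^ 2 - w| / (4 * c)) ≤ Real.exp ((X ω ^ 2 + w) / (4 * c)) := by
          gcongr; exact habs ω
      _ = Real.exp (w / (4 * c)) * Real.exp (X ω ^ 2 / (4 * c)) := by
          rw [← Real.exp_add]; congr 1; ring
      _ ≤ 3 * Real.exp (X ω ^ 2 / (4 * c)) := by gcongr
  have hs' : ∀ ω, |s * (X ω ^ 2 - w)| ≤ |X ω ^ 2 - w| / (8 * c) := by
    intro ω
    rw [abs_mul, div_eq_inv_mul, ← one_div]
    gcongr
  have hpt : ∀ ω, Real.exp (s * (X ω ^ 2 - w)) ≤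
      1 + s * (X ω ^ 2 - w) + 384 * (c : ℝ) ^ 2 * s ^ 2 * Real.exp (X ω ^ 2 / (4 * c)) := by
    intro ω
    set u := |X ω ^ 2 - w| with hu
    have e1 := exp_le_one_add_add_sq_mul (s * (X ω ^ 2 - w))
    have e2 : (X ω ^ 2 - w) ^ 2 ≤ 128 * (c : ℝ) ^ 2 * Real.exp (u / (8 * c)) := by
      have := Real.quadratic_le_exp_of_nonneg (by positivity : 0 ≤ u / (8 * c))
      have e3 : 0 ≤ u / (8 * c) := by positivity
      have e4 : (u / (8 * c)) ^ 2 / 2 ≤ Real.exp (u / (8 * c)) := by linarith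
      rw [← sq_abs, ← hu]
      have e5 : u ^ 2 = 128 * (c : ℝ) ^ 2 * ((u / (8 * c)) ^ 2 / 2) := by
        field_simp; ring
      rw [e5]
      gcongr
    have e3 : (s * (X ω ^ 2 - w)) ^ 2 * Real.exp |s * (X ω ^ 2 - w)| ≤
        384 * (c : ℝ) ^ 2 * s ^ 2 * Real.exp (X ω ^ 2 / (4 * c)) := by
      calc (s * (X ω ^ 2 - w)) ^ 2 * Real.exp |s * (X ω ^ 2 - w)|
          ≤ s ^ 2 * (128 * (c : ℝ) ^ 2 * Real.exp (u / (8 * c))) * Real.exp (u / (8 * c)) := by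
            rw [mul_pow]
            gcongr
            exact hs' ω
        _ = 128 * (c : ℝ) ^ 2 * s ^ 2 * Real.exp (u / (4 * c)) := by
            have : Real.exp (u / (4 * c)) = Real.exp (u / (8 * c)) * Real.exp (u / (8 * c)) := by
              rw [← Real.exp_add]; congr 1; field_simp; ring
            rw [this]; ring
        _ ≤ 128 * (c : ℝ) ^ 2 * s ^ 2 * (3 * Real.exp (X ω ^ 2 / (4 * c))) := by
            gcongr
            exact hbd ω
        _ = _ := by ring
    linarith
  have hint : Integrable (fun ω => Real.exp (s * (X ω ^ 2 - w))) P := by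
    refine (hI.const_mul 3).mono' (by fun_prop) (ae_of_all _ fun ω => ?_)
    rw [Real.norm_of_nonneg (Real.exp_pos _).le]
    refine le_trans (Real.exp_le_exp.2 ?_) (hbd ω)
    refine (le_abs_self _).trans ((hs' ω).trans ?_)
    gcongr
    norm_num
  refine ⟨hint, ?_⟩
  have hlin : Integrable (fun ω => 1 + s * (X ω ^ 2 - w)) P :=
    (integrable_const _).add ((hX2.sub (integrable_const _)).const_mul _)
  have hexp := hI.const_mul (384 * (c : ℝ) ^ 2 * s ^ 2)
  have h1 : mgf (fun ω => X ω ^ 2 - w) P s ≤ ∫ ω, (1 + s * (X ω ^ 2 - w) +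
      384 * (c : ℝ) ^ 2 * s ^ 2 * Real.exp (X ω ^ 2 / (4 * c))) ∂P :=
    integral_mono hint (hlin.add hexp) hpt
  have h2 : ∫ ω, (X ω ^ 2 - w) ∂P = 0 := by
    rw [integral_sub hX2 (integrable_const _)]
    simp [← hw]
  have h3 : ∫ ω, (1 + s * (X ω ^ 2 - w)) ∂P = 1 := by
    have h4 : Integrable (fun ω => s * (X ω ^ 2 - w)) P :=
      (hX2.sub (integrable_const _)).const_mul _
    rw [integral_add (integrable_const _) h4, integral_const_mul, h2]
    simp
  rw [integral_add hlin hexp, h3, integral_const_mul] at h1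
  have h4 := Real.add_one_le_exp (768 * (c : ℝ) ^ 2 * s ^ 2)
  have h5 : 384 * (c : ℝ) ^ 2 * s ^ 2 * ∫ ω, Real.exp (X ω ^ 2 / (4 * c)) ∂P ≤
      384 * (c : ℝ) ^ 2 * s ^ 2 * 2 := by gcongr
  linarith

/-- Bernstein's inequality for the sum of squares of independent sub-Gaussian variables. -/
lemma measureReal_abs_sum_sq_sub_ge_le {m : ℕ} {ε : Fin m → Ω → ℝ} (hmeas : ∀ i, Measurable (ε i))
    (hind : iIndepFun ε P) {c : ℝ≥0} (hc : 0 < c) (h : ∀ i, HasSubgaussianMGF (ε i) c P) {s : ℝ}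
    (hs0 : 0 ≤ s) (hs : s ≤ 1 / (8 * c)) (T : ℝ) :
    P.real {ω | T ≤ |∑ i, ε i ω ^ 2 - ∑ i, ∫ ω, ε i ω ^ 2 ∂P|} ≤
      2 * Real.exp (-(s * T) + m * (768 * (c : ℝ) ^ 2 * s ^ 2)) := by
  set Y : Fin m → Ω → ℝ := fun i ω => ε i ω ^ 2 - ∫ ω, ε i ω ^ 2 ∂P with hY
  have hYm : ∀ i, Measurable (Y i) := fun i => by fun_prop
  have hYind : iIndepFun Y P :=
    hind.comp (fun i x => x ^ 2 - ∫ ω, ε i ω ^ 2 ∂P) fun i => by fun_prop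
  have hsum : ∀ ω, ∑ i, ε i ω ^ 2 - ∑ i, ∫ ω, ε i ω ^ 2 ∂P = (∑ i, Y i) ω := by
    intro ω
    rw [← Finset.sum_sub_distrib, Finset.sum_apply]
  have hmgf : ∀ t : ℝ, |t| ≤ 1 / (8 * c) →
      Integrable (fun ω => Real.exp (t * (∑ i, Y i) ω)) P ∧
        mgf (∑ i, Y i) P t ≤ Real.exp (m * (768 * (c : ℝ) ^ 2 * t ^ 2)) := by
    intro t ht
    refine ⟨hYind.integrable_exp_mul_sum hYm fun i _ =>
      (mgf_sq_sub_le (hmeas i) hc (h i) ht).1, ?_⟩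
    rw [hYind.mgf_sum hYm, Real.exp_nat_mul]
    refine (Finset.prod_le_prod (fun i _ => mgf_nonneg) fun i _ =>
      (mgf_sq_sub_le (hmeas i) hc (h i) ht).2).trans (le_of_eq ?_)
    simp
  have h1 := hmgf s (by rwa [abs_of_nonneg hs0])
  have h2 := hmgf (-s) (by rwa [abs_neg, abs_of_nonneg hs0])
  have h3 := measure_ge_le_exp_mul_mgf T hs0 h1.1
  have h4 := measure_le_le_exp_mul_mgf (-T) (neg_nonpos.2 hs0) h2.1
  have h5 : {ω | T ≤ |∑ i, ε i ω ^ 2 - ∑ i, ∫ ω, ε i ω ^ 2 ∂P|} ⊆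
      {ω | T ≤ (∑ i, Y i) ω} ∪ {ω | (∑ i, Y i) ω ≤ -T} := by
    intro ω hω
    simp only [Set.mem_ofPred_eq, hsum] at hω
    rcases le_abs.1 hω with h | h
    · exact Or.inl h
    · exact Or.inr (by simp only [Set.mem_ofPred_eq]; linarith)
  refine (measureReal_mono h5).trans ((measureReal_union_le _ _).trans ?_)
  have e1 : Real.exp (-(s * T) + m * (768 * (c : ℝ) ^ 2 * s ^ 2)) =
      Real.exp (-s * T) * Real.exp (m * (768 * (c : ℝ) ^ 2 * s ^ 2)) := by
    rw [← Real.exp_add]; congr 1; ring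
  have h6 := mul_le_mul_of_nonneg_left h1.2 (Real.exp_pos (-s * T)).le
  have h7 := mul_le_mul_of_nonneg_left h2.2 (Real.exp_pos (- -s * -T)).le
  rw [neg_sq, show - -s * -T = -s * T by ring] at h7
  rw [show - -s * -T = -s * T by ring] at h4
  rw [e1]
  linarith

/-- Hoeffding's inequality for a weighted sum of independent sub-Gaussian variables. -/
lemma measureReal_abs_weighted_sum_ge_le {m : ℕ} {ε : Fin m → Ω → ℝ} (hind : iIndepFun ε P)
    {c : ℝ≥0} (h : ∀ i, HasSubgaussianMGF (ε i) c P) (a : Fin m → ℝ) {V : ℝ} (hV0 : 0 ≤ V)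
    (hV : c * ∑ i, a i ^ 2 ≤ V) {b : ℝ} (hb : 0 ≤ b) :
    P.real {ω | b ≤ |∑ i, a i * ε i ω|} ≤ 2 * Real.exp (-b ^ 2 / (2 * V)) := by
  have h1 : iIndepFun (fun i ω => a i * ε i ω) P :=
    hind.comp (fun i x => a i * x) fun i => by fun_prop
  have h2 := HasSubgaussianMGF.sum_of_iIndepFun (s := Finset.univ) h1
    fun i _ => (h i).const_mul (a i)
  have h3 : HasSubgaussianMGF (fun ω => ∑ i, a i * ε i ω) V.toNNReal P := by
    refine ⟨h2.integrable_exp_mul, fun t => (h2.mgf_le t).trans (Real.exp_le_exp.2 ?_)⟩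
    rw [Real.coe_toNNReal V hV0]
    push_cast
    gcongr
    refine le_trans (le_of_eq ?_) hV
    rw [Finset.mul_sum]
    refine Finset.sum_congr rfl fun i _ => ?_
    rw [mul_comm]
    rfl
  have h4 := h3.measure_ge_le hb
  have h5 := h3.neg.measure_ge_le hb
  rw [Real.coe_toNNReal V hV0] at h4 h5
  have h6 : {ω | b ≤ |∑ i, a i * ε i ω|} ⊆ {ω | b ≤ ∑ i, a i * ε i ω} ∪
      {ω | b ≤ (-fun ω => ∑ i, a i * ε i ω) ω} := by
    intro ω hω
    simp only [Set.mem_ofPred_eq] at hω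
    rcases le_abs.1 hω with h | h
    · exact Or.inl h
    · exact Or.inr h
  refine (measureReal_mono h6).trans ((measureReal_union_le _ _).trans ?_)
  linarith

end subgaussian

/-! ### The noise event -/

/-- Restricted isometry on the matrices `e₀ vᵀ + v e₀ᵀ` forces at least `n` measurements. Hence
`log n ≤ m`, and deviations of relative size `√(log n / m)` lie in the range where the tails of the
squared noise are still Gaussian. -/
lemma RIP.dim_le {n m k : ℕ} {A : Fin m → Matrix (Fin n) (Fin n) ℝ} {δ : ℝ} (h : RIP A k δ)
    (hk : 2 ≤ k) (hδ : δ < 1) : n ≤ m := by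
  rcases Nat.eq_zero_or_pos n with rfl | hn
  · exact Nat.zero_le _
  let u : Fin n → ℝ := Pi.single ⟨0, hn⟩ 1
  let F : (Fin n → ℝ) → Matrix (Fin n) (Fin n) ℝ := fun v => vecMulVec u v + vecMulVec v u
  let T : (Fin n → ℝ) →ₗ[ℝ] EuclideanSpace ℝ (Fin m) :=
    { toFun := fun v => sense A (F v)
      map_add' := by
        intro v w
        rw [← sense_add]
        congr 1
        simp only [F, Matrix.vecMulVec_add, Matrix.add_vecMulVec]
        abel
      map_smul' := by
        intro a v
        rw [RingHom.id_apply, ← sense_smul]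
        congr 1
        simp only [F, Matrix.vecMulVec_smul, Matrix.smul_vecMulVec, smul_add] }
  have hT : Function.Injective T := by
    rw [← LinearMap.ker_eq_bot, LinearMap.ker_eq_bot']
    intro v hv
    have hv' : sense A (F v) = 0 := hv
    have hsymm : (F v).IsSymm := by
      simp only [Matrix.IsSymm, F, Matrix.transpose_add, Matrix.transpose_vecMulVec]
      exact add_comm _ _
    have hrk : (F v).rank ≤ k := by
      refine (rank_add_le_add _ _).trans ?_
      have h1 := Matrix.rank_vecMulVec_le u v
      have h2 := Matrix.rank_vecMulVec_le v u
      omega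
    have h1 := (h (F v) hsymm hrk).1
    rw [hv'] at h1
    have h2 : F v = 0 := by
      have h3 : (1 - δ) * ‖F v‖ ^ 2 ≤ 0 := by simpa using h1
      have h4 : ‖F v‖ ^ 2 = 0 :=
        le_antisymm (nonpos_of_mul_nonpos_right h3 (by linarith)) (sq_nonneg _)
      exact norm_eq_zero.1 (pow_eq_zero_iff two_ne_zero |>.1 h4)
    have h3 : ∀ j, u ⟨0, hn⟩ * v j + v ⟨0, hn⟩ * u j = 0 := fun j =>
      congrFun (congrFun h2 ⟨0, hn⟩) j
    have h0 : v ⟨0, hn⟩ = 0 := by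
      have := h3 ⟨0, hn⟩
      simp only [u, Pi.single_eq_same] at this
      linarith
    ext j
    have := h3 j
    rw [h0] at this
    simpa [u] using this
  have := LinearMap.finrank_le_finrank_of_injective hT
  simpa using this

/-- The average `(1/m) ∑ eᵢ Aᵢ`, which represents `Y ↦ (1/m) ⟨e, 𝒜(Y)⟩`. -/
def noiseMatrix {n m : ℕ} (A : Fin m → Matrix (Fin n) (Fin n) ℝ) (e : Fin m → ℝ) :
    Matrix (Fin n) (Fin n) ℝ :=
  ∑ i, (1 / (m : ℝ) * e i) • A i

lemma ip_noiseMatrix_sum {n m : ℕ} (A : Fin m → Matrix (Fin n) (Fin n) ℝ) (e : Fin m → ℝ)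
    (Y : Matrix (Fin n) (Fin n) ℝ) :
    ip (noiseMatrix A e) Y = ∑ i, 1 / (m : ℝ) * ip (A i) Y * e i := by
  simp only [noiseMatrix, ip, Matrix.transpose_sum, Matrix.transpose_smul, Finset.sum_mul,
    Matrix.smul_mul, Matrix.trace_sum, Matrix.trace_smul, smul_eq_mul]
  exact Finset.sum_congr rfl fun i _ => by ring

lemma ip_noiseMatrix {n m : ℕ} (A : Fin m → Matrix (Fin n) (Fin n) ℝ) (e : Fin m → ℝ)
    (Y : Matrix (Fin n) (Fin n) ℝ) :
    1 / (m : ℝ) * inner ℝ (WithLp.toLp 2 e) (sense A Y) = ip (noiseMatrix A e) Y := by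
  rw [ip_noiseMatrix_sum, PiLp.inner_apply, Finset.mul_sum]
  refine Finset.sum_congr rfl fun i _ => ?_
  simp [sense, ip]
  ring

lemma ip_vecMulVec_self {n : ℕ} (S : Matrix (Fin n) (Fin n) ℝ) (u : Fin n → ℝ) :
    ip S (vecMulVec u u) = u ⬝ᵥ S *ᵥ u := by
  simp only [ip_eq_sum, Matrix.vecMulVec_apply, dotProduct, Matrix.mulVec, Finset.mul_sum]
  exact Finset.sum_congr rfl fun i _ => Finset.sum_congr rfl fun j _ => by ring

lemma norm_sq_vecMulVec_self {n : ℕ} (u : Fin n → ℝ) :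
    ‖vecMulVec u u‖ ^ 2 = (u ⬝ᵥ u) ^ 2 := by
  rw [← ip_self]
  simp only [ip_eq_sum, Matrix.vecMulVec_apply, dotProduct, sq, Finset.sum_mul_sum]
  exact Finset.sum_congr rfl fun i _ => Finset.sum_congr rfl fun j _ => by ring

/-- The upper restricted isometry bound controls the variance of the quadratic form `uᵀ S u` of the
noise matrix `S`. -/
lemma sum_sq_weights_le {n m k : ℕ} {A : Fin m → Matrix (Fin n) (Fin n) ℝ} {δ : ℝ}
    (h : RIP A k δ) (hk : 2 ≤ k) (hδ : δ < 1) {u : Fin n → ℝ} (hu : u ⬝ᵥ u ≤ 1) :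
    ∑ i, (1 / (m : ℝ) * ip (A i) (vecMulVec u u)) ^ 2 ≤ 2 / (m : ℝ) := by
  have hrk : (vecMulVec u u).rank ≤ k := (Matrix.rank_vecMulVec_le u u).trans (by omega)
  have h1 := (h (vecMulVec u u) (Matrix.transpose_vecMulVec u u) hrk).2
  have h2 : ‖sense A (vecMulVec u u)‖ ^ 2 = ∑ i, ip (A i) (vecMulVec u u) ^ 2 := by
    rw [EuclideanSpace.real_norm_sq_eq]
    rfl
  have h0 : 0 ≤ u ⬝ᵥ u := by
    simp only [dotProduct]
    exact Finset.sum_nonneg fun i _ => mul_self_nonneg _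
  have h3 : (u ⬝ᵥ u) ^ 2 ≤ 1 := pow_le_one₀ h0 hu
  rw [norm_sq_vecMulVec_self, h2] at h1
  have h4 : 1 / (m : ℝ) * ∑ i, ip (A i) (vecMulVec u u) ^ 2 ≤ 2 := by nlinarith
  calc ∑ i, (1 / (m : ℝ) * ip (A i) (vecMulVec u u)) ^ 2
      = 1 / (m : ℝ) * (1 / (m : ℝ) * ∑ i, ip (A i) (vecMulVec u u) ^ 2) := by
        rw [Finset.mul_sum, Finset.mul_sum]
        exact Finset.sum_congr rfl fun i _ => by ring
    _ ≤ 1 / (m : ℝ) * 2 := by gcongr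
    _ = 2 / m := by ring

/-- The union bound over the grid: a tail `2 exp(-6 n log n)` at each point leaves `2 / n`. -/
lemma card_grid_mul_exp_le {n : ℕ} (hn : 2 ≤ n) :
    ((8 * n + 1 : ℕ) : ℝ) ^ n * (2 * Real.exp (-(6 * n * Real.log n))) ≤ 2 / n := by
  have hn0 : (0 : ℝ) < n := by positivity
  have hn1 : (1 : ℝ) ≤ n := by exact_mod_cast (by omega : 1 ≤ n)
  have h1 : ((8 * n + 1 : ℕ) : ℝ) ≤ (n : ℝ) ^ 5 := by
    have : 8 * n + 1 ≤ n ^ 5 := by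
      have h2 : 2 ^ 4 ≤ n ^ 4 := Nat.pow_le_pow_left hn 4
      calc 8 * n + 1 ≤ 2 ^ 4 * n := by omega
        _ ≤ n ^ 4 * n := Nat.mul_le_mul_right n h2
        _ = n ^ 5 := by ring
    exact_mod_cast this
  have hL : 0 ≤ Real.log n := Real.log_nonneg hn1
  have h2 : (n : ℝ) = Real.exp (Real.log n) := (Real.exp_log hn0).symm
  have h3 : ((n : ℝ) ^ 5) ^ n = Real.exp (5 * n * Real.log n) := by
    rw [← pow_mul]
    conv_lhs => rw [h2]
    rw [← Real.exp_nat_mul]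
    congr 1
    push_cast
    ring
  calc ((8 * n + 1 : ℕ) : ℝ) ^ n * (2 * Real.exp (-(6 * n * Real.log n)))
      ≤ ((n : ℝ) ^ 5) ^ n * (2 * Real.exp (-(6 * n * Real.log n))) := by gcongr
    _ = 2 * Real.exp (-(n * Real.log n)) := by
        rw [h3, mul_left_comm, ← Real.exp_add]
        congr 2
        ring
    _ ≤ 2 * Real.exp (-Real.log n) := by
        gcongr
        exact le_mul_of_one_le_left hL hn1
    _ = 2 / n := by rw [Real.exp_neg, Real.exp_log hn0]; rfl

/-- With high probability the noise is almost orthogonal to all symmetric matrices of low rank, and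
its empirical variance is close to `σ²`. The numerical constants make every tail at a grid point
`2 exp(-6 n log n)` and the tail of the empirical variance `2 / n`. -/
lemma exists_noise_event {n m r : ℕ} {A : Fin m → Matrix (Fin n) (Fin n) ℝ} {δ κ σ : ℝ}
    (hA : RIP A (2 * r) δ) (hn : 2 ≤ n) (hr : 1 ≤ r) (hδ : δ < 1) (hκ : 0 < κ)
    {Ω : Type*} [MeasurableSpace Ω] {P : Measure Ω} [IsProbabilityMeasure P]
    {ε : Fin m → Ω → ℝ} (hmeas : ∀ i, Measurable (ε i)) (hind : iIndepFun ε P)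
    (hσ0 : 0 ≤ σ) (hσ : σ ^ 2 = 1 / (m : ℝ) * ∑ i, ∫ ω, ε i ω ^ 2 ∂P)
    (hsub : ∀ i, HasSubgaussianMGF (ε i) (κ * σ ^ 2).toNNReal P) :
    ∃ G : Set Ω, MeasurableSet G ∧ 1 - 4 / (n : ℝ) ≤ P.real G ∧ ∀ ω ∈ G,
      (∀ Y : Matrix (Fin n) (Fin n) ℝ, Yᵀ = Y → Y.rank ≤ 2 * r →
        |1 / (m : ℝ) * inner ℝ (WithLp.toLp 2 fun i => ε i ω) (sense A Y)| ≤
          √(192 * κ * (σ ^ 2 * n * r * Real.log n / m)) * ‖Y‖) ∧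
      |1 / (m : ℝ) * ‖(WithLp.toLp 2 fun i => ε i ω : EuclideanSpace ℝ (Fin m))‖ ^ 2 - σ ^ 2| ≤
        104 * κ * σ ^ 2 * √(Real.log n / m) := by
  have hnm : n ≤ m := hA.dim_le (by omega) hδ
  have hn0 : (0 : ℝ) < n := by positivity
  have hn1 : (1 : ℝ) ≤ n := by exact_mod_cast (by omega : 1 ≤ n)
  have hm0 : (0 : ℝ) < m := by
    have : 0 < m := by omega
    exact_mod_cast this
  have hL : 0 ≤ Real.log n := Real.log_nonneg hn1
  have hLm : Real.log n ≤ m := by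
    have h1 := Real.log_le_self hn0.le
    have h2 : (n : ℝ) ≤ m := by exact_mod_cast hnm
    linarith
  have hnorm : ∀ ω, ‖(WithLp.toLp 2 fun i => ε i ω : EuclideanSpace ℝ (Fin m))‖ ^ 2 =
      ∑ i, ε i ω ^ 2 := fun ω => by rw [EuclideanSpace.real_norm_sq_eq]
  rcases hσ0.eq_or_lt with rfl | hσp
  · -- without noise variance, the noise vanishes almost surely
    have hae : ∀ᵐ ω ∂P, ∀ i, ε i ω = 0 := by
      rw [ae_all_iff]
      intro i
      have := hsub i
      simp only [ne_eq, OfNat.ofNat_ne_zero, not_false_eq_true, zero_pow, mul_zero,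
        Real.toNNReal_zero] at this
      exact this.ae_eq_zero_of_hasSubgaussianMGF_zero
    have hm : MeasurableSet {ω | ∀ i, ε i ω = 0} := by
      rw [Set.ofPred_forall]
      exact MeasurableSet.iInter fun i => hmeas i (measurableSet_singleton 0)
    refine ⟨{ω | ∀ i, ε i ω = 0}, ?_, ?_, ?_⟩
    · exact hm
    · have h1 : P.real {ω | ∀ i, ε i ω = 0} = 1 := by
        rw [measureReal_def, (mem_ae_iff_prob_eq_one hm).1 hae, ENNReal.toReal_one]
      rw [h1]
      have : 0 ≤ 4 / (n : ℝ) := by positivity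
      linarith
    · intro ω hω
      have h0 : (fun i => ε i ω) = 0 := funext hω
      rw [h0]
      simp
  have hσ2 : 0 < σ ^ 2 := by positivity
  set c : ℝ≥0 := (κ * σ ^ 2).toNNReal with hc
  have hcv : (c : ℝ) = κ * σ ^ 2 := Real.coe_toNNReal _ (by positivity)
  have hc0 : 0 < c := Real.toNNReal_pos.2 (by positivity)
  have hc0' : (0 : ℝ) < c := hc0
  set b := √(24 * κ * (σ ^ 2 * n * Real.log n / m)) with hb
  have hb0 : 0 ≤ b := Real.sqrt_nonneg _
  have hb2 : b ^ 2 = 24 * κ * (σ ^ 2 * n * Real.log n / m) := Real.sq_sqrt (by positivity)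
  set d := 104 * κ * σ ^ 2 * √(Real.log n / m) with hd
  let Z : (Fin n → Fin (8 * n + 1)) → Ω → ℝ := fun z ω =>
    ∑ i, 1 / (m : ℝ) * ip (A i) (vecMulVec (gridPoint z) (gridPoint z)) * ε i ω
  have hZm : ∀ z, Measurable (Z z) := fun z => by fun_prop
  let Bz : (Fin n → Fin (8 * n + 1)) → Set Ω := fun z =>
    {ω | gridPoint z ⬝ᵥ gridPoint z ≤ 1 ∧ b ≤ |Z z ω|}
  let Bd : Set Ω := {ω | m * d ≤ |∑ i, ε i ω ^ 2 - ∑ i, ∫ ω, ε i ω ^ 2 ∂P|}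
  have hBz : ∀ z, P.real (Bz z) ≤ 2 * Real.exp (-(6 * n * Real.log n)) := by
    intro z
    by_cases hz : gridPoint z ⬝ᵥ gridPoint z ≤ 1
    · have h1 := sum_sq_weights_le hA (by omega) hδ hz
      have h2 := measureReal_abs_weighted_sum_ge_le hind hsub
        (fun i => 1 / (m : ℝ) * ip (A i) (vecMulVec (gridPoint z) (gridPoint z)))
        (V := c * (2 / m)) (by positivity) (mul_le_mul_of_nonneg_left h1 hc0'.le) hb0
      refine (measureReal_mono fun ω hω => hω.2).trans (h2.trans (le_of_eq ?_))
      congr 2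
      rw [hb2, hcv]
      field_simp
      ring
    · have : Bz z = ∅ := by
        ext ω
        simp [Bz, hz]
      rw [this, measureReal_empty]
      positivity
  have hBd : P.real Bd ≤ 2 / n := by
    -- with the parameter `√(log n / m) / (8 c)` the Bernstein exponent is `(-13 + 12) log n`
    have hs : √(Real.log n / m) / (8 * c) ≤ 1 / (8 * c) := by
      gcongr
      rw [Real.sqrt_le_one]
      rwa [div_le_one hm0]
    refine (measureReal_abs_sum_sq_sub_ge_le hmeas hind hc0 hsub (by positivity) hs _).trans
      (le_of_eq ?_)
    have h1 : √(Real.log n / m) ^ 2 = Real.log n / m := Real.sq_sqrt (by positivity)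
    have h2 : -(√(Real.log n / m) / (8 * c) * (m * d)) +
        m * (768 * (c : ℝ) ^ 2 * (√(Real.log n / m) / (8 * c)) ^ 2) = -Real.log n := by
      have e1 : √(Real.log n / m) / (8 * c) * (m * d) =
          13 * m * √(Real.log n / m) ^ 2 := by
        rw [hd, hcv]; field_simp; ring
      have e2 : m * (768 * (c : ℝ) ^ 2 * (√(Real.log n / m) / (8 * c)) ^ 2) =
          12 * m * √(Real.log n / m) ^ 2 := by
        field_simp; ring
      rw [e1, e2, h1]
      field_simp
      ring
    rw [h2, Real.exp_neg, Real.exp_log hn0]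
    rfl
  have hZmeas : ∀ z, MeasurableSet (Bz z) := fun z =>
    (MeasurableSet.const _).inter (measurableSet_le measurable_const (hZm z).abs)
  have hDmeas : MeasurableSet Bd := measurableSet_le measurable_const (by fun_prop)
  refine ⟨((⋃ z, Bz z) ∪ Bd)ᶜ, ((MeasurableSet.iUnion hZmeas).union hDmeas).compl, ?_, ?_⟩
  · rw [probReal_compl_eq_one_sub ((MeasurableSet.iUnion hZmeas).union hDmeas)]
    have h1 : P.real (⋃ z, Bz z) ≤ 2 / n := by
      refine (measureReal_iUnion_fintype_le _).trans ((Finset.sum_le_sum fun z _ => hBz z).trans ?_)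
      rw [Finset.sum_const, Finset.card_univ, Fintype.card_fun, Fintype.card_fin,
        Fintype.card_fin, nsmul_eq_mul, Nat.cast_pow]
      exact card_grid_mul_exp_le hn
    have h2 := measureReal_union_le (μ := P) (⋃ z, Bz z) Bd
    have h3 : 4 / (n : ℝ) = 2 / n + 2 / n := by ring
    linarith
  · intro ω hω
    simp only [Set.mem_compl_iff, Set.mem_union, Set.mem_iUnion, not_or, not_exists] at hω
    obtain ⟨hω1, hω2⟩ := hω
    constructor
    · intro Y hY hYr
      have hgrid : ∀ z, gridPoint z ⬝ᵥ gridPoint z ≤ 1 →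
          |gridPoint z ⬝ᵥ noiseMatrix A (fun i => ε i ω) *ᵥ gridPoint z| ≤ b := by
        intro z hz
        rw [← ip_vecMulVec_self, ip_noiseMatrix_sum]
        by_contra! hcon
        exact hω1 z ⟨hz, hcon.le⟩
      rw [ip_noiseMatrix]
      have := abs_ip_le_of_quadratic_le (abs_quadratic_le_of_grid _ hgrid) (by positivity) hY hYr
      refine this.trans (le_of_eq ?_)
      congr 1
      rw [← Real.sqrt_sq (show 0 ≤ 2 * b * √((2 * r : ℕ) : ℝ) by positivity)]
      congr 1
      have h1 : √((2 * r : ℕ) : ℝ) ^ 2 = 2 * r := by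
        rw [Real.sq_sqrt (by positivity)]; push_cast; ring
      calc _ = 4 * b ^ 2 * √((2 * r : ℕ) : ℝ) ^ 2 := by ring
        _ = _ := by rw [h1, hb2]; ring
    · rw [hnorm, hσ, ← mul_sub, abs_mul, abs_of_pos (by positivity), one_div,
        inv_mul_le_iff₀ hm0]
      by_contra! hcon
      exact hω2 hcon.le

end PrecGD

theorem theorem8 (δ₀ : ℝ) (hδ₀ : δ₀ < 1) :
    ∃ L : ℝ, 0 < L ∧
    ∀ κ : ℝ, 0 < κ →
    ∃ C c c' : ℝ, 0 < C ∧ 0 < c ∧ 0 < c' ∧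
    ∀ (n m r rs : ℕ) (δ ρ σ : ℝ)
      (A : Fin m → Matrix (Fin n) (Fin n) ℝ) (Mstar : Matrix (Fin n) (Fin n) ℝ)
      (hM : Mstar.PosSemidef)
      (Ω : Type*) [MeasurableSpace Ω] (P : Measure Ω) [IsProbabilityMeasure P]
      (ε : Fin m → Ω → ℝ),
      Mstar ≠ 0 → Mstar.rank = rs → rs ≤ r →
      0 ≤ δ → δ ≤ δ₀ → PrecGD.RIP A (2 * r) δ →
      0 < ρ → ρ < 1 → ρ ^ 2 / (1 - ρ ^ 2) ≤ (1 - δ ^ 2) / 2 →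
      (∀ i, Measurable (ε i)) → iIndepFun ε P → (∀ i, ∫ ω, ε i ω ∂P = 0) →
      0 ≤ σ → σ ^ 2 = 1 / (m : ℝ) * ∑ i, ∫ ω, ε i ω ^ 2 ∂P →
      (∀ i, HasSubgaussianMGF (ε i) (κ * σ ^ 2).toNNReal P) →
      ∃ G : Set Ω, MeasurableSet G ∧ 1 - c * (n : ℝ) ^ (-c') ≤ P.real G ∧
        ∀ ω ∈ G, ∀ (y : EuclideanSpace ℝ (Fin m)) (X₀ : Matrix (Fin n) (Fin r) ℝ)
          (X : ℕ → Matrix (Fin n) (Fin r) ℝ) (η : ℕ → ℝ) (α σhat μP : ℝ) (K kstar : ℕ),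
          y = PrecGD.noisyData A Mstar (fun i => ε i ω) →
          X = PrecGD.iter A y σhat α X₀ →
          η = (fun k => PrecGD.damping A y σhat (X k)) →
          μP = PrecGD.muP δ √(1 + δ) r rs →
          1 / (m : ℝ) * ‖PrecGD.sense A (X₀ * X₀ᵀ - Mstar)‖ ^ 2
            < ρ ^ 2 * (1 - δ) * PrecGD.lam hM.isHermitian rs ^ 2 →
          0 < α → α ≤ 1 / L →
          kstar ≤ K → (∀ k ≤ K, η kstar ≤ η k) →
          ‖X kstar * (X kstar)ᵀ - Mstar‖ ^ 2 ≤
            C * max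
              (max ((1 + δ) / (1 - δ) * (1 - α * μP / 2) ^ K * ‖X₀ * X₀ᵀ - Mstar‖ ^ 2)
                (PrecGD.errStat n m r σ δ μP))
              (max (PrecGD.errDev n m σ δ) (PrecGD.errVar σ σhat)) := by
  refine ⟨8 * PrecGD.stepConst √((1 - δ₀) / 2), ?_, ?_⟩
  · unfold PrecGD.stepConst
    positivity
  intro κ hκ
  have hν : 0 < 1 - δ₀ := by linarith
  refine ⟨2 / (1 - δ₀) * (3 * (6400 * (1 + 192 * κ) / (1 - δ₀) ^ 2) + 5 * (1 + 192 * κ) +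
    2 * (1 + 192 * κ) / (1 - δ₀)), 4, 1, by positivity, by norm_num, by norm_num, ?_⟩
  intro n m r rs δ ρ σ A Mstar hM Ω _ P _ ε hM0 hrank hrs hδ hδδ hA hρ0 hρ1 hρ hmeas hind _ hσ0 hσ
    hsub
  have hδ1 : δ < 1 := by linarith
  have hrs1 : 1 ≤ rs := by
    rw [← hrank]
    rw [Nat.one_le_iff_ne_zero, hM.isHermitian.rank_eq_card_non_zero_eigs]
    intro h
    rw [Fintype.card_eq_zero_iff] at h
    refine hM0 (hM.isHermitian.eigenvalues_eq_zero_iff.1 (funext fun i => ?_))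
    by_contra hi
    exact h.false ⟨i, hi⟩
  rcases Nat.lt_or_ge n 2 with hn | hn
  · -- for `n = 1` the claimed probability is not positive
    refine ⟨∅, MeasurableSet.empty, ?_, by simp⟩
    interval_cases n
    · exact absurd (Subsingleton.elim _ _) hM0
    · norm_num
  obtain ⟨G, hGm, hG, hgood⟩ := PrecGD.exists_noise_event hA hn (hrs1.trans hrs) hδ1 hκ hmeas
    hind hσ0 hσ hsub
  refine ⟨G, hGm, ?_, ?_⟩
  · rw [Real.rpow_neg_one, ← div_eq_mul_inv]
    exact hG
  intro ω hω y X₀ X η α σhat μP K kstar hy hX hη hμP hinit hα hαL hkK hmin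
  obtain ⟨hnoise, hdev⟩ := hgood ω hω
  have hn1 : (1 : ℝ) ≤ n := by exact_mod_cast (by omega : 1 ≤ n)
  have hL : 0 ≤ Real.log n := Real.log_nonneg hn1
  have hμ0 : 0 < μP := by
    rw [hμP]; exact PrecGD.muP_pos hδ hδ1 (Real.sqrt_nonneg _) r rs
  have hδp : 0 < 1 - δ := by linarith
  set B := max (PrecGD.errStat n m r σ δ μP)
    (max (PrecGD.errDev n m σ δ) (PrecGD.errVar σ σhat)) with hB
  have hB0 : 0 ≤ B := by
    refine le_trans ?_ ((le_max_right _ _).trans (le_max_right _ _))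
    exact abs_nonneg _
  have hstat : PrecGD.errStat n m r σ δ μP ≤ B := le_max_left _ _
  have hdevB : PrecGD.errDev n m σ δ ≤ B := (le_max_left _ _).trans (le_max_right _ _)
  have hvarB : PrecGD.errVar σ σhat ≤ B := (le_max_right _ _).trans (le_max_right _ _)
  have hone : 1 ≤ 1 / (1 - δ) := by
    rw [le_div_iff₀ hδp]; linarith
  subst hX
  subst hη
  rw [max_assoc, ← hB, hμP]
  refine PrecGD.convergence_of_noise_le (d := 104 * κ * σ ^ 2 * √(Real.log n / m)) hδ₀
    (by linarith) hM hrank hrs hδ hδδ hA hρ0 hρ1 hρ hy hnoise hdev (Real.sqrt_nonneg _) hB0 ?_ ?_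
    hvarB hinit hα hαL hmin
  · rw [Real.sq_sqrt (by positivity), ← hμP]
    have h1 : σ ^ 2 * n * r * Real.log n / m ≤ μP * PrecGD.errStat n m r σ δ μP := by
      have e1 : μP * PrecGD.errStat n m r σ δ μP =
          σ ^ 2 * n * r * Real.log n / m * (1 / (1 - δ)) := by
        unfold PrecGD.errStat
        field_simp
      rw [e1]
      exact le_mul_of_one_le_right (by positivity) hone
    have h2 : μP * PrecGD.errStat n m r σ δ μP ≤ μP * B :=
      mul_le_mul_of_nonneg_left hstat hμ0.le
    have h3 : 192 * κ * (σ ^ 2 * n * r * Real.log n / m) ≤ 192 * κ * (μP * B) :=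
      mul_le_mul_of_nonneg_left (h1.trans h2) (by positivity)
    have h4 : 0 ≤ μP * B := by positivity
    linarith
  · have h1 : σ ^ 2 * √(Real.log n / m) ≤ PrecGD.errDev n m σ δ := by
      have e1 : PrecGD.errDev n m σ δ = σ ^ 2 * √(Real.log n / m) * (1 / (1 - δ)) := by
        unfold PrecGD.errDev; ring
      rw [e1]
      exact le_mul_of_one_le_right (by positivity) hone
    have h2 : 104 * κ * (σ ^ 2 * √(Real.log n / m)) ≤ 104 * κ * B :=
      mul_le_mul_of_nonneg_left (h1.trans hdevB) (by positivity)
    have h3 : 0 ≤ κ * B := by positivity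
    linarith

end
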